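/- Let $k$ be a field and let $A$ be a finite-dimensional (associative, unital) $k$-algebra with radical $r$, and write $A/r=\overline A_1\oplus\cdots\oplus\overline A_s$ as the direct sum of its simple ideals. Modules are left modules. *Ordinary quiver.* $\Gamma_A$ has as vertices the isomorphism classes of simple $A$-modules $S_x$, and the number of arrows from $x$ to $y$ is $m_{xy}=\dim_k\mathrm{Ext}^1_A(S_x,S_y)$. *Natural quiver.* $\Delta_A$ has as vertices the simple ideals $\overline A_1,\dots,\overline A_s$ of $A/r$. The number $t_{ij}$ of arrows from $i$ to $j$ is the least cardinality of a generating set of the $\overline A_j$-$\overline A_i$-bimodule ${}_jM_i=\overline A_j\cdot (r/r^2)\cdot\overline A_i$, where $\bar a\cdot\bar x\cdot\bar b=\overline{axb}$. *Basic algebra.* Let $\varepsilon_1,\dots,\varepsilon_n\in A$ be a complete set of non-isomorphic primitive orthogonal idempotents: the $\varepsilon_i$ are primitive and pairwise orthogonal idempotents, $A\varepsilon_i\not\cong A\varepsilon_j$ for $i\ne j$, and for every primitive idempotent $f$ of $A$ the module $Af$ is isomorphic to some $A\varepsilon_i$. Put $\varepsilon=\varepsilon_1+\cdots+\varepsilon_n$,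 and let $B\cong\varepsilon A\varepsilon=\bigoplus_{i,j}\varepsilon_iA\varepsilon_j$ be the basic algebra of $A$. A sub-quiver $Q'$ of a quiver $Q$ is called *dense* if it has the same vertices as $Q$ and, for all vertices $i,j$, there is an arrow from $i$ to $j$ in $Q'$ if and only if there is one in $Q$. Vertices are identified as follows: the class of a simple $A$-module $S$ with the class of the simple $B$-module $\varepsilon S$; and, for $A$ and likewise for $B$, a simple ideal of the algebra modulo its radical with the class of the simple modules on which it acts nontrivially. These identifications are bijections of the vertex sets, and with respect to them the following hold. (i) $\Gamma_A=\Gamma_B$. (ii) If $k$ is algebraically closed, then $\Gamma_B=\Delta_B$. (iii) If $k$ is algebraically closed, then $\Delta_A$ is a dense sub-quiver of $\Gamma_A$, and also of $\Gamma_B$ and of $\Delta_B$. (In particular, the number of arrows between any two vertices of $\Delta_A$ is at most the corresponding number in $\Gamma_A$, in $\Gamma_B$ and in $\Delta_B$.) -/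

import Mathlib

open CategoryTheory
open scoped ModuleCat.Algebra

universe w u

/-! ### Quivers -/

/-- A morphism of quivers that is bijective on vertices and on arrows. -/
def IsQuiverIso {V V' : Type*} [Quiver V] [Quiver V'] (F : V ⥤q V') : Prop :=
  Function.Bijective F.obj ∧
    ∀ x y : V, Function.Bijective (fun a : x ⟶ y => F.map a)

/-- `F` identifies its source with a dense sub-quiver of its target: a sub-quiver with all the
vertices, in which there is an arrow from `x` to `y` iff there is one in the whole quiver. -/
def IsDenseSubquiverEmbedding {V V' : Type*} [Quiver V] [Quiver V'] (F : V ⥤q V') : Prop :=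
  Function.Bijective F.obj ∧
    (∀ x y : V, Function.Injective (fun a : x ⟶ y => F.map a)) ∧
    ∀ x y : V, Nonempty (x ⟶ y) ↔ Nonempty (F.obj x ⟶ F.obj y)

/-! ### The ordinary quiver -/

/-- Simple left `A`-modules. -/
def SimpleMod (A : Type u) [Ring A] : Type (u + 1) :=
  {S : ModuleCat.{u} A // IsSimpleModule A S}

/-- Isomorphism of simple modules. -/
instance SimpleMod.isoSetoid (A : Type u) [Ring A] : Setoid (SimpleMod A) where
  r S T := Nonempty (S.1 ≃ₗ[A] T.1)
  iseqv := ⟨fun _ => ⟨LinearEquiv.refl _ _⟩, fun ⟨f⟩ => ⟨f.symm⟩, fun ⟨f⟩ ⟨g⟩ => ⟨f.trans g⟩⟩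

/-- The (vertices of the) ordinary quiver of a `k`-algebra `A`: isomorphism classes of simple
left `A`-modules. -/
@[nolint unusedArguments]
def OrdinaryQuiver (k : Type w) (A : Type u) [Field k] [Ring A] [Algebra k A] : Type (u + 1) :=
  Quotient (SimpleMod.isoSetoid A)

namespace OrdinaryQuiver

variable {k : Type w} {A : Type u} [Field k] [Ring A] [Algebra k A]

/-- A simple module representing the vertex `x`. -/
noncomputable def simple (x : OrdinaryQuiver k A) : ModuleCat.{u} A :=
  (Quotient.out (s := SimpleMod.isoSetoid A) x).1

/-- The number `m_{xy} = dim_k Ext¹_A(S_x, S_y)` of arrows from `x` to `y`. -/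
noncomputable def arrowCount (x y : OrdinaryQuiver k A) : Cardinal.{u} :=
  Module.rank k (Abelian.Ext.{u} x.simple y.simple 1)

/-- The arrows from `x` to `y` form a set of cardinality `arrowCount x y`. -/
noncomputable instance : Quiver (OrdinaryQuiver k A) where
  Hom x y := Quotient.out (arrowCount x y)

end OrdinaryQuiver

/-! ### The natural quiver -/

section Natural

variable {A : Type u} [Ring A]

/-- The bimodule `I · r/r² · J`, inside `r/r² ⊆ A/r²`, for ideals `I`, `J` of `A/r`, where `r` is
the radical of `A`. The action of `A/r` on `r/r²` is `ā · x̄ · b̄ = (axb)̄`. -/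
def arrowBimodule (I J : TwoSidedIdeal (A ⧸ Ring.jacobson A)) :
    AddSubgroup (A ⧸ Ring.jacobson A ^ 2) :=
  AddSubgroup.closure {m | ∃ a x b : A,
    Ideal.Quotient.mk (Ring.jacobson A) a ∈ I ∧ x ∈ Ring.jacobson A ∧
    Ideal.Quotient.mk (Ring.jacobson A) b ∈ J ∧
    m = Ideal.Quotient.mk (Ring.jacobson A ^ 2) (a * x * b)}

/-- `X` generates `I · r/r² · J` as an `I`-`J`-bimodule: `X` lies in it, and every additive
subgroup that contains `X` and is stable under `I` on the left and `J` on the right is all of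
it. -/
def GeneratesArrowBimodule (I J : TwoSidedIdeal (A ⧸ Ring.jacobson A))
    (X : Set (A ⧸ Ring.jacobson A ^ 2)) : Prop :=
  X ⊆ arrowBimodule I J ∧
    ∀ N : AddSubgroup (A ⧸ Ring.jacobson A ^ 2), N ≤ arrowBimodule I J → X ⊆ N →
      (∀ a : A, Ideal.Quotient.mk (Ring.jacobson A) a ∈ I →
        ∀ m ∈ N, Ideal.Quotient.mk (Ring.jacobson A ^ 2) a * m ∈ N) →
      (∀ b : A, Ideal.Quotient.mk (Ring.jacobson A) b ∈ J →
        ∀ m ∈ N, m * Ideal.Quotient.mk (Ring.jacobson A ^ 2) b ∈ N) →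
      N = arrowBimodule I J

/-- The rank of the `I`-`J`-bimodule `I · r/r² · J`: the least cardinality of a generating set. -/
noncomputable def arrowBimoduleRank (I J : TwoSidedIdeal (A ⧸ Ring.jacobson A)) : Cardinal.{u} :=
  sInf {c | ∃ X : Set (A ⧸ Ring.jacobson A ^ 2),
    GeneratesArrowBimodule I J X ∧ Cardinal.mk X = c}

end Natural

/-- The (vertices of the) natural quiver of `A`: the simple ideals of `A/r`, that is, its minimal
nonzero two-sided ideals, which are the simple blocks of `A/r` when `A` is artinian. -/
def NaturalQuiver (A : Type u) [Ring A] : Type u :=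
  {I : TwoSidedIdeal (A ⧸ Ring.jacobson A) // IsAtom I}

namespace NaturalQuiver

variable {A : Type u} [Ring A]

/-- The number `t_{ij}` of arrows from `i` to `j`: the rank of `_jM_i = A_j · r/r² · A_i`. -/
noncomputable def arrowCount (i j : NaturalQuiver A) : Cardinal.{u} :=
  arrowBimoduleRank j.1 i.1

/-- The arrows from `i` to `j` form a set of cardinality `arrowCount i j`. -/
noncomputable instance : Quiver (NaturalQuiver A) where
  Hom i j := Quotient.out (arrowCount i j)

end NaturalQuiver

/-- The vertex `i` of the natural quiver and the vertex `x` of the ordinary quiver correspond: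
the simple ideal `A_i` of `A/r` acts nontrivially on the simple module `S_x`. -/
def ActsOn {k : Type w} {A : Type u} [Field k] [Ring A] [Algebra k A]
    (i : NaturalQuiver A) (x : OrdinaryQuiver k A) : Prop :=
  ∃ a : A, Ideal.Quotient.mk (Ring.jacobson A) a ∈ i.1 ∧ ∃ s : x.simple, a • s ≠ 0

/-! ### The basic algebra -/

section Basic

variable {A : Type u} [Ring A]

/-- A primitive idempotent: a nonzero idempotent that is not a sum of two nonzero orthogonal
idempotents. -/
def IsPrimitiveIdempotent (f : A) : Prop :=
  IsIdempotentElem f ∧ f ≠ 0 ∧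
    ∀ g h : A, IsIdempotentElem g → IsIdempotentElem h → g * h = 0 → h * g = 0 →
      f = g + h → g = 0 ∨ h = 0

/-- A complete set of non-isomorphic primitive orthogonal idempotents; `Ideal.span {f}` is the
left ideal `A f`. -/
structure IsCompletePrimitiveSet {n : ℕ} (e : Fin n → A) : Prop where
  primitive : ∀ i, IsPrimitiveIdempotent (e i)
  orthogonal : ∀ i j, i ≠ j → e i * e j = 0
  nonIso : ∀ i j, i ≠ j → IsEmpty (Ideal.span {e i} ≃ₗ[A] Ideal.span {e j})
  complete : ∀ f : A, IsPrimitiveIdempotent f →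
    ∃ i, Nonempty (Ideal.span {f} ≃ₗ[A] Ideal.span {e i})

end Basic

/-- `φ` is an isomorphism of `k`-algebras from `B` onto the basic algebra `ε A ε` of `A`, where
`ε = ∑ i, e i` for a complete set `e` of non-isomorphic primitive orthogonal idempotents. (The
unit of `ε A ε` is `ε`, so `φ` is a non-unital homomorphism into `A`; `φ 1 = ε` is automatic.) -/
structure IsBasicAlgebra {k : Type w} {A B : Type u} [Field k] [Ring A] [Algebra k A]
    [Ring B] [Algebra k B] {n : ℕ} (e : Fin n → A) (φ : B →ₙₐ[k] A) : Prop where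
  idempotents : IsCompletePrimitiveSet e
  injective : Function.Injective φ
  range_eq : Set.range φ = {x | ∃ a : A, x = (∑ i, e i) * a * ∑ i, e i}

/-- The vertices `x` of `Γ_A` and `y` of `Γ_B` correspond: the simple `B`-module `S_y` is
isomorphic, via `φ : B ≅ ε A ε`, to the `ε A ε`-module `ε S_x`. -/
def IsCornerOf {k : Type w} {A B : Type u} [Field k] [Ring A] [Algebra k A]
    [Ring B] [Algebra k B] {n : ℕ} (e : Fin n → A) (φ : B →ₙₐ[k] A)
    (x : OrdinaryQuiver k A) (y : OrdinaryQuiver k B) : Prop :=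
  ∃ f : y.simple →+ x.simple, Function.Injective f ∧
    Set.range f = {s | ∃ t : x.simple, s = (∑ i, e i) • t} ∧
    ∀ (b : B) (t : y.simple), f (b • t) = φ b • f t

/-! ### Simple modules and the Jacobson radical -/

section SimpleModules

variable {R : Type u} [Ring R]

/-! The idempotent `ε` is full. If all `ε b` lay in a maximal left ideal `m`, every `e i = e i * ε`
would kill the simple module `A ⧸ m`, but completeness of the set gives an `e i` nonzero on each
nonzero module. Hence `M ↦ ε M` is a `k`-linear equivalence from `A`-modules to `B`-modules. It
preserves simple modules and the dimension of `Ext¹`, which is (i).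

Let `k` be algebraically closed. By Fitting's lemma, primitive idempotents nonzero on a common
simple module are equivalent, so exactly one `e i` of `B` is nonzero on a given simple module, and
it acts there as the identity. The corner of `e i` is `k • e i` up to nilpotents, so `B` acts on its
simple modules by scalars and `B/r` is a direct sum of lines `k • e i`. Generating a bimodule then
means spanning over `k`, and the arrows of `Δ_B` are counted by `dim e i (r/r²) e j`
(`arrowBimoduleRank_eq_rank_arrowSpace`). From `0 → r e j → B e j → S_j → 0` one gets `Ext¹(S_j,
S_i) ≅ Hom_B(r e j, S_i) ≅ Hom_k(e i (r/r²) e j, S_i)` with `S_i` a line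
(`rank_ext_eq_rank_arrowSpace`). This is (ii).

For (iii), `Δ_A` is compared with `Δ_B`. A simple ideal of `A/r` contains the `e i` nonzero on its
simple module and is generated by it, so generators of `e i (r/r²) e j` for `B` map to generators of
the bimodule for `A`: arrow numbers do not increase (`IsBasicAlgebra.arrowBimoduleRank_le`).
Fullness pulls `ε r² ε` back into the squared radical of `B`, so a bimodule that is zero for `A` is
zero for `B` (`IsBasicAlgebra.arrowBimoduleRank_eq_zero`). -/

lemma exists_smul_eq_of_ne_zero {S : Type*} [AddCommGroup S] [Module R S] [IsSimpleModule R S]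
    {s : S} (hs : s ≠ 0) (t : S) : ∃ a : R, a • s = t :=
  IsSimpleModule.toSpanSingleton_surjective R hs t

lemma jacobson_smul_eq_zero {S : Type*} [AddCommGroup S] [Module R S] [IsSimpleModule R S]
    {a : R} (ha : a ∈ Ring.jacobson R) (s : S) : a • s = 0 :=
  Module.mem_annihilator.1 (IsSemisimpleModule.jacobson_le_annihilator R S ha) s

lemma mem_jacobson_of_forall_isMaximal {a : R}
    (h : ∀ m : Ideal R, m.IsMaximal → ∀ s : R ⧸ m, a • s = 0) : a ∈ Ring.jacobson R := by
  rw [Ring.jacobson_eq_sInf_isMaximal, Submodule.mem_sInf]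
  intro m hm
  have := h m hm (Submodule.Quotient.mk 1)
  rwa [← Submodule.Quotient.mk_smul, smul_eq_mul, mul_one, Submodule.Quotient.mk_eq_zero] at this

lemma isSimpleModule_quotient {m : Ideal R} (hm : m.IsMaximal) : IsSimpleModule R (R ⧸ m) :=
  isSimpleModule_iff_isCoatom.2 hm.out

/-- An ideal of `R` modulo its radical acts nontrivially on a module. -/
def ActsNontrivially (I : TwoSidedIdeal (R ⧸ Ring.jacobson R)) (S : Type*) [AddCommGroup S]
    [Module R S] : Prop :=
  ∃ a : R, Ideal.Quotient.mk (Ring.jacobson R) a ∈ I ∧ ∃ s : S, a • s ≠ 0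

lemma ActsNontrivially.congr {I : TwoSidedIdeal (R ⧸ Ring.jacobson R)} {S T : Type*}
    [AddCommGroup S] [Module R S] [AddCommGroup T] [Module R T] (h : ActsNontrivially I S)
    (f : S ≃ₗ[R] T) : ActsNontrivially I T := by
  obtain ⟨a, ha, s, hs⟩ := h
  refine ⟨a, ha, f s, ?_⟩
  rw [← map_smul]
  exact fun h => hs (f.map_eq_zero_iff.1 h)

lemma ActsNontrivially.mono {I J : TwoSidedIdeal (R ⧸ Ring.jacobson R)} {S : Type*}
    [AddCommGroup S] [Module R S] (h : ActsNontrivially I S) (hIJ : I ≤ J) :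
    ActsNontrivially J S := by
  obtain ⟨a, ha, s, hs⟩ := h
  exact ⟨a, hIJ ha, s, hs⟩

/-- A nonzero ideal of `R` modulo its radical acts nontrivially on some simple module. -/
lemma exists_isMaximal_actsNontrivially {I : TwoSidedIdeal (R ⧸ Ring.jacobson R)} (hI : I ≠ ⊥) :
    ∃ m : Ideal R, m.IsMaximal ∧ ActsNontrivially I (R ⧸ m) := by
  by_contra! h
  apply hI
  refine le_bot_iff.1 fun x hx => ?_
  obtain ⟨a, rfl⟩ := Ideal.Quotient.mk_surjective x
  rw [TwoSidedIdeal.mem_bot, Ideal.Quotient.eq_zero_iff_mem]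
  refine mem_jacobson_of_forall_isMaximal fun m hm s => ?_
  by_contra hs
  exact h m hm ⟨a, hx, s, hs⟩

/-- Two minimal ideals of `R` modulo its radical acting on the same simple module coincide. -/
lemma eq_of_isAtom_of_actsNontrivially {I J : TwoSidedIdeal (R ⧸ Ring.jacobson R)} (hI : IsAtom I)
    (hJ : IsAtom J) {S : Type*} [AddCommGroup S] [Module R S] [IsSimpleModule R S]
    (hIS : ActsNontrivially I S) (hJS : ActsNontrivially J S) : I = J := by
  by_contra hne
  have hbot : I ⊓ J = ⊥ := (hI.disjoint_of_ne hJ hne).eq_bot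
  obtain ⟨a, ha, s, hs⟩ := hIS
  obtain ⟨b, hb, t, ht⟩ := hJS
  obtain ⟨c, hc⟩ := exists_smul_eq_of_ne_zero (R := R) ht s
  have hmem : Ideal.Quotient.mk (Ring.jacobson R) (a * (c * b)) ∈ I ⊓ J := by
    rw [TwoSidedIdeal.mem_inf, map_mul, map_mul]
    exact ⟨I.mul_mem_right _ _ ha, J.mul_mem_left _ _ (J.mul_mem_left _ _ hb)⟩
  rw [hbot, TwoSidedIdeal.mem_bot, Ideal.Quotient.eq_zero_iff_mem] at hmem
  apply hs
  rw [← hc, ← mul_smul, ← mul_smul, mul_assoc]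
  exact jacobson_smul_eq_zero hmem t

/-- If `L` is minimal among the left ideals that do not annihilate the simple module `S`, then `S`
is the only simple module that `L` does not annihilate. -/
lemma nonempty_linearEquiv_of_minimal {S T : Type*} [AddCommGroup S] [Module R S]
    [IsSimpleModule R S] [AddCommGroup T] [Module R T] [IsSimpleModule R T] {L : Ideal R}
    (hLS : ∃ a ∈ L, ∃ s : S, a • s ≠ 0)
    (hmin : ∀ L' < L, ∀ a ∈ L', ∀ s : S, a • s = 0)
    (hLT : ∃ a ∈ L, ∃ t : T, a • t ≠ 0) : Nonempty (T ≃ₗ[R] S) := by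
  obtain ⟨a, ha, s, hs⟩ := hLS
  obtain ⟨b, hb, t, ht⟩ := hLT
  let f : L →ₗ[R] S := (LinearMap.toSpanSingleton R S s).comp L.subtype
  let g : L →ₗ[R] T := (LinearMap.toSpanSingleton R T t).comp L.subtype
  have hf : f ≠ 0 := fun h => hs (by simpa [f] using LinearMap.congr_fun h ⟨a, ha⟩)
  have hg : g ≠ 0 := fun h => ht (by simpa [g] using LinearMap.congr_fun h ⟨b, hb⟩)
  have hgs : Function.Surjective g := LinearMap.surjective_of_ne_zero hg
  have hfs : Function.Surjective f := LinearMap.surjective_of_ne_zero hf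
  -- The kernel of `g` is a left ideal strictly inside `L`, so it annihilates `S` by minimality;
  -- thus `f` factors through `L / ker g ≅ T`.
  have hle : LinearMap.ker g ≤ LinearMap.ker f := by
    intro x hx
    have hlt : (LinearMap.ker g).map L.subtype < L := by
      refine lt_of_le_of_ne (Submodule.map_subtype_le _ _) fun h => ht ?_
      rw [← h] at hb
      obtain ⟨y, hy, hyb⟩ := hb
      have : g y = 0 := hy
      rw [← hyb]
      simpa [g] using this
    have := hmin _ hlt x.1 ⟨x, hx, rfl⟩ s
    simpa [f] using this
  let F : (L ⧸ LinearMap.ker g) →ₗ[R] S := (LinearMap.ker g).liftQ f hle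
  have e := g.quotKerEquivOfSurjective hgs
  have := IsSimpleModule.congr e
  have hF : F ≠ 0 := fun h => hf (by
    ext x
    have := LinearMap.congr_fun h (Submodule.Quotient.mk x)
    simpa [F] using this)
  exact ⟨e.symm.trans (LinearEquiv.ofBijective F (LinearMap.bijective_of_ne_zero hF))⟩

/-- Every simple module over an artinian ring `R` is acted on nontrivially by a minimal ideal of
`R` modulo its radical, which annihilates all other simple modules. -/
lemma exists_isAtom_actsNontrivially [IsArtinianRing R] (S : Type u) [AddCommGroup S] [Module R S]
    [IsSimpleModule R S] : ∃ I : TwoSidedIdeal (R ⧸ Ring.jacobson R), IsAtom I ∧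
      ActsNontrivially I S ∧ ∀ (T : Type u) [AddCommGroup T] [Module R T] [IsSimpleModule R T],
        ActsNontrivially I T → Nonempty (T ≃ₗ[R] S) := by
  have := IsSimpleModule.nontrivial R S
  obtain ⟨s₀, hs₀⟩ := exists_ne (0 : S)
  obtain ⟨L, ⟨a, ha, s, hs⟩, hmin⟩ := IsArtinian.set_has_minimal
    {L : Ideal R | ∃ a ∈ L, ∃ s : S, a • s ≠ 0} ⟨⊤, 1, trivial, s₀, by simpa using hs₀⟩
  replace hmin : ∀ L' < L, ∀ a ∈ L', ∀ s : S, a • s = 0 := fun L' hL' a ha s => by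
    by_contra h
    exact hmin L' ⟨a, ha, s, h⟩ hL'
  let I : TwoSidedIdeal (R ⧸ Ring.jacobson R) :=
    TwoSidedIdeal.span (Ideal.Quotient.mk (Ring.jacobson R) '' L)
  have hL : ∀ a ∈ L, Ideal.Quotient.mk (Ring.jacobson R) a ∈ I := fun a ha =>
    TwoSidedIdeal.subset_span ⟨a, ha, rfl⟩
  have huniq : ∀ (T : Type u) [AddCommGroup T] [Module R T] [IsSimpleModule R T],
      ActsNontrivially I T → Nonempty (T ≃ₗ[R] S) := by
    intro T _ _ _ hT
    refine nonempty_linearEquiv_of_minimal ⟨a, ha, s, hs⟩ hmin ?_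
    by_contra! h
    obtain ⟨b, hb, t, ht⟩ := hT
    have key : ∀ x ∈ I, ∀ b : R, Ideal.Quotient.mk (Ring.jacobson R) b = x →
        ∀ t : T, b • t = 0 := by
      -- This ideal is the annihilator of `T` in `R/r`. Asking the condition of every representative
      -- loses nothing, as the radical kills `T`.
      have hK : I ≤ TwoSidedIdeal.mk' {x | ∀ b : R, Ideal.Quotient.mk (Ring.jacobson R) b = x →
          ∀ t : T, b • t = 0}
          (fun b hb t => jacobson_smul_eq_zero (Ideal.Quotient.eq_zero_iff_mem.1 hb) t)
          (by
            intro x y hx hy b hb t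
            obtain ⟨c, rfl⟩ := Ideal.Quotient.mk_surjective x
            have := hy (b - c) (by rw [map_sub, hb]; abel) t
            rw [← sub_add_cancel b c, add_smul, this, hx c rfl, add_zero])
          (by
            intro x hx b hb t
            have := hx (-b) (by rw [map_neg, hb, neg_neg]) t
            rwa [neg_smul, neg_eq_zero] at this)
          (by
            intro x y hy b hb t
            obtain ⟨c, rfl⟩ := Ideal.Quotient.mk_surjective x
            obtain ⟨d, rfl⟩ := Ideal.Quotient.mk_surjective y
            have h1 := jacobson_smul_eq_zero (S := T)
              (Ideal.Quotient.eq.1 (hb.trans (map_mul _ c d).symm)) t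
            rw [sub_smul, mul_smul, hy d rfl, smul_zero, sub_zero] at h1
            exact h1)
          (by
            intro x y hx b hb t
            obtain ⟨c, rfl⟩ := Ideal.Quotient.mk_surjective x
            obtain ⟨d, rfl⟩ := Ideal.Quotient.mk_surjective y
            have h1 := jacobson_smul_eq_zero (S := T)
              (Ideal.Quotient.eq.1 (hb.trans (map_mul _ c d).symm)) t
            rw [sub_smul, mul_smul, hx c rfl, sub_zero] at h1
            exact h1) := by
        refine TwoSidedIdeal.span_le.2 ?_
        rintro _ ⟨a, ha, rfl⟩
        simp only [SetLike.mem_coe, TwoSidedIdeal.mem_mk', Set.mem_ofPred_eq]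
        intro b hb t
        have h1 := jacobson_smul_eq_zero (S := T) (Ideal.Quotient.eq.1 hb) t
        rwa [sub_smul, h a ha, sub_zero] at h1
      intro x hx
      simpa using hK hx
    exact ht (key _ hb b rfl t)
  refine ⟨I, ⟨?_, ?_⟩, ⟨a, hL a ha, s, hs⟩, huniq⟩
  · rintro h
    have := hL a ha
    rw [h, TwoSidedIdeal.mem_bot, Ideal.Quotient.eq_zero_iff_mem] at this
    exact hs (jacobson_smul_eq_zero this s)
  · intro J hJ
    by_contra hne
    obtain ⟨m, hm, hJm⟩ := exists_isMaximal_actsNontrivially hne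
    have := isSimpleModule_quotient hm
    obtain ⟨e⟩ := huniq _ (hJm.mono hJ.le)
    obtain ⟨b, hb, t, ht⟩ := hJm.congr e
    obtain ⟨c, rfl⟩ := exists_smul_eq_of_ne_zero (R := R) hs t
    refine hJ.not_ge (TwoSidedIdeal.span_le.2 ?_)
    rintro _ ⟨x, hx, rfl⟩
    -- `L'` contains `b * c * a`, which does not kill `s`, so minimality of `L` forces `L' = L`,
    -- that is, `L` maps into `J`.
    let L' : Ideal R := L ⊓ (TwoSidedIdeal.asIdeal J).comap (Ideal.Quotient.mk (Ring.jacobson R))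
    have hL' : L' = L := by
      by_contra hL'
      refine ht ?_
      rw [← mul_smul, ← mul_smul]
      refine hmin L' (lt_of_le_of_ne inf_le_left hL') _ ⟨Ideal.mul_mem_left L _ ha, ?_⟩ s
      rw [SetLike.mem_coe, Ideal.mem_comap, TwoSidedIdeal.mem_asIdeal, map_mul, map_mul]
      exact J.mul_mem_right _ _ (J.mul_mem_right _ _ hb)
    rw [SetLike.mem_coe, ← hL'] at hx
    simpa using hx.2

/-- Simple modules acted on nontrivially by the same minimal ideal are isomorphic. -/
lemma nonempty_linearEquiv_of_actsNontrivially [IsArtinianRing R]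
    {I : TwoSidedIdeal (R ⧸ Ring.jacobson R)} (hI : IsAtom I) (S T : Type u)
    [AddCommGroup S] [Module R S] [IsSimpleModule R S]
    [AddCommGroup T] [Module R T] [IsSimpleModule R T]
    (hS : ActsNontrivially I S) (hT : ActsNontrivially I T) : Nonempty (T ≃ₗ[R] S) := by
  obtain ⟨J, hJ, hJS, h⟩ := exists_isAtom_actsNontrivially (R := R) S
  rw [eq_of_isAtom_of_actsNontrivially hI hJ hS hJS] at hT
  exact h T hT

end SimpleModules

/-! ### Primitive idempotents -/

section Idempotents

variable {A : Type u} [Ring A]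

/-- Write the minimal polynomial as `X ^ m * q` with `q(0) ≠ 0`. Then `X` is invertible modulo `q`,
and `d` is its inverse evaluated at `c`. -/
lemma exists_pow_eq_pow_succ_mul_of_isIntegral {k : Type w} [Field k] [Algebra k A] {c : A}
    (hc : IsIntegral k c) : ∃ (m : ℕ) (d : A), Commute c d ∧ c ^ m = c ^ (m + 1) * d := by
  obtain ⟨q, hq, hdvd⟩ := Polynomial.exists_eq_pow_rootMultiplicity_mul_and_not_dvd
    (minpoly k c) (minpoly.ne_zero hc) 0
  set m := Polynomial.rootMultiplicity 0 (minpoly k c)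
  rw [Polynomial.C_0, sub_zero] at hq hdvd
  rw [Polynomial.X_dvd_iff] at hdvd
  refine ⟨m, Polynomial.aeval c (Polynomial.C (-(q.coeff 0)⁻¹) * q.divX), ?_, ?_⟩
  · have := (Commute.all (Polynomial.X : Polynomial k)
      (Polynomial.C (-(q.coeff 0)⁻¹) * q.divX)).map (Polynomial.aeval c)
    simpa using this
  · have h0 := minpoly.aeval k c
    rw [hq] at h0
    have : (Polynomial.X ^ m : Polynomial k) = Polynomial.X ^ (m + 1) *
        (Polynomial.C (-(q.coeff 0)⁻¹) * q.divX) +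
        Polynomial.C (q.coeff 0)⁻¹ * (Polynomial.X ^ m * q) := by
      have h1 : Polynomial.C (q.coeff 0)⁻¹ * Polynomial.C (q.coeff 0) = 1 := by
        rw [← Polynomial.C_mul, inv_mul_cancel₀ hdvd, Polynomial.C_1]
      have h2 := Polynomial.divX_mul_X_add q
      rw [Polynomial.C_neg]
      linear_combination (-Polynomial.X ^ m) * h1 +
        Polynomial.X ^ m * Polynomial.C (q.coeff 0)⁻¹ * h2
    have := congrArg (Polynomial.aeval c) this
    rw [map_add, map_mul _ (Polynomial.C (q.coeff 0)⁻¹), h0, mul_zero, add_zero] at this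
    simpa using this

/-- Fitting's lemma: an element of the corner of a primitive idempotent is nilpotent or
invertible in the corner. -/
lemma IsPrimitiveIdempotent.isNilpotent_or_exists_inverse {k : Type w} [Field k] [Algebra k A]
    {e c : A} (he : IsPrimitiveIdempotent e) (hec : e * c = c) (hce : c * e = c)
    (hc : IsIntegral k c) : IsNilpotent c ∨ ∃ d : A, c * d = e ∧ d * c = e := by
  obtain ⟨m, d, hcd, hm⟩ := exists_pow_eq_pow_succ_mul_of_isIntegral hc
  have hpow : ∀ j : ℕ, c ^ m = c ^ (m + j) * d ^ j := by
    intro j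
    induction j with
    | zero => simp
    | succ j ih =>
      calc c ^ m = c ^ m * c ^ j * d ^ j := by rw [← pow_add, ← ih]
        _ = c ^ (m + 1) * (d * c ^ j) * d ^ j := by rw [← mul_assoc, ← hm]
        _ = c ^ (m + (j + 1)) * d ^ (j + 1) := by
          rw [← (hcd.pow_left j).eq, pow_succ' d, ← mul_assoc, ← mul_assoc, ← pow_add]
          congr 2
          ring_nf
  have hcomm : Commute (c ^ (m + 1)) (d ^ (m + 1)) := hcd.pow_pow _ _
  have hcg : c ^ (m + 1) * (c ^ (m + 1) * d ^ (m + 1)) = c ^ (m + 1) := by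
    rw [← mul_assoc, ← pow_add, pow_succ c m, show m + 1 + (m + 1) = (m + (m + 1)) + 1 by ring,
      pow_succ' c (m + (m + 1)), mul_assoc, ← hpow, ← pow_succ', pow_succ]
  -- `g` is the idempotent of the invertible part of `c`; primitivity makes it `0` or `e`. The
  -- exponent is `m + 1` so that `g` lies in the corner of `e` even when `m = 0`.
  set g := c ^ (m + 1) * d ^ (m + 1) with hg
  have hgg : g * g = g := by
    calc g * g = d ^ (m + 1) * (c ^ (m + 1) * g) := by
          nth_rw 1 [hg]
          rw [hcomm.eq, mul_assoc]
      _ = g := by rw [hcg, ← hcomm.eq]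
  have heg : e * g = g := by rw [hg, pow_succ', ← mul_assoc, ← mul_assoc, hec]
  have hge : g * e = g := by rw [hg, hcomm.eq, mul_assoc, pow_succ c, mul_assoc, hce]
  have hee : e * e = e := he.1
  rcases he.2.2 g (e - g) hgg
    (by rw [IsIdempotentElem, mul_sub, sub_mul, sub_mul, hee, heg, hge, hgg, sub_self, sub_zero])
    (by rw [mul_sub, hge, hgg, sub_self]) (by rw [sub_mul, heg, hgg, sub_self])
    (by abel) with h | h
  · left
    exact ⟨m + 1, by rw [← hcg, h, mul_zero]⟩
  · right
    have h' : e = g := sub_eq_zero.1 h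
    refine ⟨c ^ m * d ^ (m + 1), ?_, ?_⟩
    · rw [← mul_assoc, ← pow_succ', h']
    · rw [mul_assoc, ← (hcd.pow_right (m + 1)).eq, ← mul_assoc, ← pow_succ, h']

/-- Primitive idempotents acting nontrivially on the same simple module are equivalent. -/
lemma IsPrimitiveIdempotent.exists_mul_eq_of_smul_ne_zero (k : Type w) [Field k] [Algebra k A]
    [Algebra.IsIntegral k A] {e f : A} (he : IsPrimitiveIdempotent e)
    (hf : IsPrimitiveIdempotent f) {S : Type*} [AddCommGroup S] [Module A S] [IsSimpleModule A S]
    {s t : S} (hs : e • s ≠ 0) (ht : f • t ≠ 0) :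
    ∃ u v : A, u * v = e ∧ v * u = f ∧ e * u = u ∧ u * f = u ∧ f * v = v ∧ v * e = v := by
  have hee : e * e = e := he.1
  have hff : f * f = f := hf.1
  obtain ⟨a, ha⟩ := exists_smul_eq_of_ne_zero (R := A) ht (e • s)
  obtain ⟨b, hb⟩ := exists_smul_eq_of_ne_zero (R := A) hs (f • t)
  have hu : (e * a * f) • f • t = e • s := by
    rw [mul_smul, mul_smul, ← mul_smul f f, hff, ha, ← mul_smul, hee]
  have hv : (f * b * e) • e • s = f • t := by
    rw [mul_smul, mul_smul, ← mul_smul e e, hee, hb, ← mul_smul, hff]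
  set u := e * a * f with hu'
  set v := f * b * e with hv'
  have heu : e * u = u := by rw [hu', ← mul_assoc, ← mul_assoc, hee]
  have huf : u * f = u := by rw [hu', mul_assoc, hff]
  have hfv : f * v = v := by rw [hv', ← mul_assoc, ← mul_assoc, hff]
  have hve : v * e = v := by rw [hv', mul_assoc, hee]
  have not_nilp : ∀ {c : A} {x : S}, c • x = x → x ≠ 0 → ¬ IsNilpotent c := by
    rintro c x hcx hx ⟨n, hn⟩
    have : ∀ n : ℕ, c ^ n • x = x := fun n => by
      induction n with
      | zero => simp
      | succ n ih => rw [pow_succ, mul_smul, hcx, ih]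
    exact hx (by rw [← this n, hn, zero_smul])
  -- `u * v` fixes the nonzero vector `e • s`, hence is not nilpotent; likewise `v * u` fixes `f •
  -- t`.
  obtain ⟨d, hd, -⟩ := (he.isNilpotent_or_exists_inverse (k := k) (c := u * v)
    (by rw [← mul_assoc, heu]) (by rw [mul_assoc, hve])
    (Algebra.IsIntegral.isIntegral _)).resolve_left
    (not_nilp (x := e • s) (by rw [mul_smul, hv, hu]) hs)
  obtain ⟨d', -, hd'⟩ := (hf.isNilpotent_or_exists_inverse (k := k) (c := v * u)
    (by rw [← mul_assoc, hfv]) (by rw [mul_assoc, huf])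
    (Algebra.IsIntegral.isIntegral _)).resolve_left
    (not_nilp (x := f • t) (by rw [mul_smul, hu, hv]) ht)
  -- The left and right inverses of `u` so obtained agree, so `v * d * e` is a two-sided partner of
  -- `u`.
  have key : f * d' * v = v * d := by
    calc f * d' * v = f * d' * v * (u * v * d) := by rw [hd, mul_assoc (f * d'), hve]
      _ = f * (d' * (v * u)) * (v * d) := by simp only [mul_assoc]
      _ = v * d := by rw [hd', hff, ← mul_assoc, hfv]
  refine ⟨u, v * d * e, ?_, ?_, heu, huf, ?_, ?_⟩
  · rw [← mul_assoc, ← mul_assoc, hd, hee]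
  · rw [mul_assoc, heu, ← key, mul_assoc, mul_assoc, hd', hff]
  · rw [← mul_assoc, ← mul_assoc, hfv]
  · rw [mul_assoc, hee]

/-- Equivalent idempotents generate isomorphic left ideals. -/
lemma nonempty_span_singleton_linearEquiv {e f u v : A} (huv : u * v = e) (hvu : v * u = f)
    (heu : e * u = u) (hfv : f * v = v) :
    Nonempty (Ideal.span {e} ≃ₗ[A] Ideal.span {f}) := by
  have hee : e * e = e := by nth_rw 2 [← huv]; rw [← mul_assoc, heu, huv]
  have hff : f * f = f := by nth_rw 2 [← hvu]; rw [← mul_assoc, hfv, hvu]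
  have huf : u * f = u := by rw [← hvu, ← mul_assoc, huv, heu]
  have hve : v * e = v := by rw [← huv, ← mul_assoc, hvu, hfv]
  let F : Ideal.span {e} →ₗ[A] Ideal.span {f} :=
    ((LinearMap.toSpanSingleton A A u).comp (Ideal.span {e}).subtype).codRestrict _ fun x => by
      refine Ideal.mem_span_singleton'.2 ⟨x.1 * u, ?_⟩
      simp [mul_assoc, huf]
  let G : Ideal.span {f} →ₗ[A] Ideal.span {e} :=
    ((LinearMap.toSpanSingleton A A v).comp (Ideal.span {f}).subtype).codRestrict _ fun x => by
      refine Ideal.mem_span_singleton'.2 ⟨x.1 * v, ?_⟩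
      simp [mul_assoc, hve]
  refine ⟨LinearEquiv.ofLinearMap F G ?_ ?_⟩
  · ext x
    obtain ⟨y, hy⟩ := Ideal.mem_span_singleton'.1 x.2
    simp [F, G, mul_assoc, hvu, ← hy, hff]
  · ext x
    obtain ⟨y, hy⟩ := Ideal.mem_span_singleton'.1 x.2
    simp [F, G, mul_assoc, huv, ← hy, hee]

/-- An idempotent whose left ideal is isomorphic to `A f` acts nontrivially on the modules on which
`f` does. -/
lemma exists_smul_ne_zero_of_linearEquiv {e f : A} (he : IsIdempotentElem e)
    (ψ : Ideal.span {f} ≃ₗ[A] Ideal.span {e}) {S : Type*}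
    [AddCommGroup S] [Module A S] {s : S} (hs : f • s ≠ 0) : ∃ t : S, e • t ≠ 0 := by
  let f' : Ideal.span {f} := ⟨f, Ideal.mem_span_singleton_self f⟩
  let e' : Ideal.span {e} := ⟨e, Ideal.mem_span_singleton_self e⟩
  obtain ⟨x, hx⟩ := Ideal.mem_span_singleton'.1 (ψ f').2
  have h1 : ψ f' = (ψ f' : A) • e' := by
    apply Subtype.ext
    change (ψ f' : A) = (ψ f' : A) * e
    rw [← hx, mul_assoc, he.eq]
  have h2 : f = x * e * (ψ.symm e' : A) := by
    have := congrArg (fun y => (ψ.symm y : A)) h1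
    simpa [f', ← hx] using this
  refine ⟨(ψ.symm e' : A) • s, fun h => hs ?_⟩
  rw [h2, mul_smul, mul_smul, h, smul_zero]

/-- Every nonzero module over an artinian ring is acted on nontrivially by a primitive
idempotent. -/
lemma exists_isPrimitiveIdempotent_smul_ne_zero [IsArtinianRing A] (S : Type*) [AddCommGroup S]
    [Module A S] [Nontrivial S] : ∃ f : A, IsPrimitiveIdempotent f ∧ ∃ s : S, f • s ≠ 0 := by
  obtain ⟨s₀, hs₀⟩ := exists_ne (0 : S)
  obtain ⟨_, ⟨f, hf, rfl, s, hs⟩, hmin⟩ := IsArtinian.set_has_minimal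
    {L : Ideal A | ∃ f : A, IsIdempotentElem f ∧ L = Ideal.span {f} ∧ ∃ s : S, f • s ≠ 0}
    ⟨_, 1, IsIdempotentElem.one, rfl, s₀, by simpa using hs₀⟩
  -- Here `A g ≤ A f`, and minimality gives equality, so `f ∈ A g` and `h = f * h = 0`. One of the
  -- two summands of `f` must act nontrivially, so this settles primitivity.
  have key : ∀ g h : A, IsIdempotentElem g → g * h = 0 → h * g = 0 → IsIdempotentElem h →
      f = g + h → (∃ s : S, g • s ≠ 0) → h = 0 := by
    intro g h hg hgh hhg hh hfgh hs
    by_contra hne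
    refine hmin _ ⟨g, hg, rfl, hs⟩ (lt_of_le_of_ne ?_ fun heq => hne ?_)
    · rw [Ideal.span_singleton_le_iff_mem]
      refine Ideal.mem_span_singleton'.2 ⟨g, ?_⟩
      rw [hfgh, mul_add, hg.eq, hgh, add_zero]
    · obtain ⟨x, hx⟩ := Ideal.mem_span_singleton'.1
        (heq ▸ Ideal.mem_span_singleton_self f : f ∈ Ideal.span {g})
      have h1 : f * h = h := by rw [hfgh, add_mul, hgh, hh.eq, zero_add]
      rw [← h1, ← hx, mul_assoc, hgh, mul_zero]
  refine ⟨f, ⟨hf, fun h => hs (by rw [h, zero_smul]), fun g h hg hh hgh hhg hfgh => ?_⟩, s, hs⟩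
  by_cases hgs : ∃ s : S, g • s ≠ 0
  · exact Or.inr (key g h hg hgh hhg hh hfgh hgs)
  · refine Or.inl (key h g hh hhg hgh hg (by rw [hfgh, add_comm]) ⟨s, fun h' => hs ?_⟩)
    push Not at hgs
    rw [hfgh, add_smul, hgs, h', add_zero]

namespace IsCompletePrimitiveSet

variable {n : ℕ} {e : Fin n → A}

lemma sum_mul (he : IsCompletePrimitiveSet e) (i : Fin n) : (∑ j, e j) * e i = e i := by
  rw [Finset.sum_mul, Finset.sum_eq_single i (fun j _ hj => he.orthogonal j i hj) (by simp)]
  exact (he.primitive i).1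

lemma mul_sum (he : IsCompletePrimitiveSet e) (i : Fin n) : e i * (∑ j, e j) = e i := by
  rw [Finset.mul_sum, Finset.sum_eq_single i (fun j _ hj => he.orthogonal i j hj.symm) (by simp)]
  exact (he.primitive i).1

lemma isIdempotentElem_sum (he : IsCompletePrimitiveSet e) :
    IsIdempotentElem (∑ j, e j) := by
  rw [IsIdempotentElem, Finset.mul_sum]
  exact Finset.sum_congr rfl fun i _ => he.sum_mul i

lemma exists_smul_ne_zero [IsArtinianRing A] (he : IsCompletePrimitiveSet e) (S : Type*)
    [AddCommGroup S] [Module A S] [Nontrivial S] : ∃ i, ∃ s : S, e i • s ≠ 0 := by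
  obtain ⟨f, hf, s, hs⟩ := exists_isPrimitiveIdempotent_smul_ne_zero (A := A) S
  obtain ⟨i, ⟨ψ⟩⟩ := he.complete f hf
  exact ⟨i, exists_smul_ne_zero_of_linearEquiv (he.primitive i).1 ψ hs⟩

/-- The sum of a complete set of primitive idempotents is a full idempotent. -/
lemma exists_sum_eq_one [IsArtinianRing A] (he : IsCompletePrimitiveSet e) :
    ∃ (T : Finset A) (a : A → A), ∑ b ∈ T, a b * (∑ i, e i) * b = 1 := by
  -- This left ideal is `A ε A`. Inside a maximal `m` it would make `ε`, hence each `e i`, kill the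
  -- simple module `A ⧸ m`.
  have htop : Ideal.span (Set.range fun b : A => (∑ i, e i) * b) = ⊤ := by
    by_contra h
    obtain ⟨m, hm, hle⟩ := Ideal.exists_le_maximal _ h
    have := isSimpleModule_quotient hm
    have := IsSimpleModule.nontrivial A (A ⧸ m)
    obtain ⟨i, s, hs⟩ := he.exists_smul_ne_zero (A ⧸ m)
    obtain ⟨b, rfl⟩ := Submodule.Quotient.mk_surjective _ s
    apply hs
    have hb : (∑ i, e i) • (Submodule.Quotient.mk b : A ⧸ m) = 0 :=
      (Submodule.Quotient.mk_eq_zero m).2 (hle (Ideal.subset_span ⟨b, rfl⟩))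
    rw [← he.mul_sum i, mul_smul, hb, smul_zero]
  have h1 : (1 : A) ∈ Ideal.span (Set.range fun b : A => (∑ i, e i) * b) := by
    rw [htop]; trivial
  obtain ⟨c, hc⟩ := (Finsupp.mem_span_range_iff_exists_finsupp).1 h1
  exact ⟨c.support, c, by simpa [Finsupp.sum, mul_assoc] using hc⟩

end IsCompletePrimitiveSet

end Idempotents

/-! ### The corner functor of a full idempotent -/

/-- `φ` is an isomorphism from `B` onto `ε A ε`, where `ε` is an idempotent with `A ε A = A`. -/
structure IsFullCorner {k : Type w} {A B : Type u} [Field k] [Ring A] [Algebra k A] [Ring B]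
    [Algebra k B] (ε : A) (φ : B →ₙₐ[k] A) : Prop where
  isIdempotentElem : IsIdempotentElem ε
  injective : Function.Injective φ
  range_eq : Set.range φ = {x | ∃ a : A, x = ε * a * ε}
  exists_sum_eq_one : ∃ (T : Finset A) (a : A → A), ∑ b ∈ T, a b * ε * b = 1

lemma IsBasicAlgebra.isFullCorner {k : Type w} {A B : Type u} [Field k] [Ring A] [Algebra k A]
    [FiniteDimensional k A] [Ring B] [Algebra k B] {n : ℕ} {e : Fin n → A} {φ : B →ₙₐ[k] A}
    (hB : IsBasicAlgebra e φ) : IsFullCorner (∑ i, e i) φ where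
  isIdempotentElem := hB.idempotents.isIdempotentElem_sum
  injective := hB.injective
  range_eq := hB.range_eq
  exists_sum_eq_one :=
    have := IsArtinianRing.of_finite k A
    hB.idempotents.exists_sum_eq_one

namespace IsFullCorner

variable {k : Type w} {A B : Type u} [Field k] [Ring A] [Algebra k A] [Ring B]
    [Algebra k B] {ε : A} {φ : B →ₙₐ[k] A}

lemma exists_eq (h : IsFullCorner ε φ) (a : A) : ∃ b : B, φ b = ε * a * ε := by
  have : ε * a * ε ∈ Set.range φ := by rw [h.range_eq]; exact ⟨a, rfl⟩
  exact this

/-- The element of `B` corresponding to `ε a ε`. -/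
noncomputable def compress (h : IsFullCorner ε φ) (a : A) : B := (h.exists_eq a).choose

@[simp]
lemma map_compress (h : IsFullCorner ε φ) (a : A) : φ (h.compress a) = ε * a * ε :=
  (h.exists_eq a).choose_spec

lemma left_mul (h : IsFullCorner ε φ) (b : B) : ε * φ b = φ b := by
  have : φ b ∈ Set.range φ := ⟨b, rfl⟩
  rw [h.range_eq] at this
  obtain ⟨a, ha⟩ := this
  rw [ha, ← mul_assoc, ← mul_assoc, h.isIdempotentElem.eq]

lemma right_mul (h : IsFullCorner ε φ) (b : B) : φ b * ε = φ b := by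
  have : φ b ∈ Set.range φ := ⟨b, rfl⟩
  rw [h.range_eq] at this
  obtain ⟨a, ha⟩ := this
  rw [ha, mul_assoc, h.isIdempotentElem.eq]

lemma apply_one (h : IsFullCorner ε φ) : φ 1 = ε := by
  have h1 := h.map_compress 1
  rw [mul_one, h.isIdempotentElem.eq] at h1
  have h2 := h.left_mul 1
  rwa [← h1, ← map_mul, mul_one, h1, eq_comm] at h2

@[simp]
lemma compress_map (h : IsFullCorner ε φ) (b : B) : h.compress (φ b) = b :=
  h.injective (by rw [h.map_compress, h.left_mul, h.right_mul])

/-- The `B`-module `ε M`. -/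
@[nolint unusedArguments]
def Corner (_ : IsFullCorner ε φ) (M : Type*) [AddCommGroup M] [Module A M] : Type _ :=
  (DistribSMul.toAddMonoidHom M ε - AddMonoidHom.id M).ker

/-! ### Corner modules and full faithfulness -/

section Corner

variable (h : IsFullCorner ε φ) {M N : Type*} [AddCommGroup M] [Module A M] [AddCommGroup N]
  [Module A N]

instance : AddCommGroup (h.Corner M) :=
  inferInstanceAs (AddCommGroup (DistribSMul.toAddMonoidHom M ε - AddMonoidHom.id M).ker)

/-- The inclusion of `ε M` in `M`. -/
def incl : h.Corner M →+ M := (DistribSMul.toAddMonoidHom M ε - AddMonoidHom.id M).ker.subtype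

lemma incl_injective : Function.Injective (h.incl (M := M)) := Subtype.val_injective

@[simp]
lemma smul_incl (m : h.Corner M) : ε • h.incl m = h.incl m :=
  sub_eq_zero.1 (AddMonoidHom.mem_ker.1 m.2)

/-- Elements of `M` fixed by `ε`, as elements of `ε M`. -/
def mkCorner (m : M) (hm : ε • m = m) : h.Corner M := ⟨m, AddMonoidHom.mem_ker.2 (sub_eq_zero.2 hm)⟩

@[simp]
lemma incl_mkCorner (m : M) (hm : ε • m = m) : h.incl (h.mkCorner m hm) = m := rfl

instance : SMul B (h.Corner M) where
  smul b m := h.mkCorner (φ b • h.incl m) (by rw [← mul_smul, h.left_mul])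

@[simp]
lemma incl_smul (b : B) (m : h.Corner M) : h.incl (b • m) = φ b • h.incl m := rfl

instance : Module B (h.Corner M) where
  one_smul m := h.incl_injective (by simp [h.apply_one])
  mul_smul a b m := h.incl_injective (by simp [mul_smul])
  smul_zero a := h.incl_injective (by simp)
  smul_add a m m' := h.incl_injective (by simp)
  add_smul a b m := h.incl_injective (by simp [add_smul])
  zero_smul m := h.incl_injective (by simp)

/-- The map `ε M → ε N` induced by a linear map `M → N`. -/
def cornerMap (f : M →ₗ[A] N) : h.Corner M →ₗ[B] h.Corner N where
  toFun m := h.mkCorner (f (h.incl m)) (by rw [← map_smul, h.smul_incl])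
  map_add' m m' := h.incl_injective (by simp)
  map_smul' b m := h.incl_injective (by simp)

@[simp]
lemma incl_cornerMap (f : M →ₗ[A] N) (m : h.Corner M) :
    h.incl (h.cornerMap f m) = f (h.incl m) := rfl

/-- The component `ε m` in `ε M` of an element of `M`. -/
def proj (m : M) : h.Corner M :=
  h.mkCorner (ε • m) (by rw [← mul_smul, h.isIdempotentElem.eq])

@[simp]
lemma incl_proj (m : M) : h.incl (h.proj m) = ε • m := rfl

lemma proj_add (m m' : M) : h.proj (m + m') = h.proj m + h.proj m' :=
  h.incl_injective (by simp)

/-- Since `1 = ∑ a ε b`, every `m` is `∑ a • (ε b m)`, so a linear map is determined by its values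
on `ε M`. -/
lemma cornerMap_injective : Function.Injective (h.cornerMap (M := M) (N := N)) := by
  intro f g hfg
  obtain ⟨T, a, ha⟩ := h.exists_sum_eq_one
  have key (f : M →ₗ[A] N) (m : M) :
      f m = ∑ b ∈ T, a b • h.incl (h.cornerMap f (h.proj (b • m))) := by
    nth_rw 1 [← one_smul A m, ← ha]
    simp [Finset.sum_smul, mul_smul]
  ext m
  rw [key f, key g, hfg]

/-- The only possible extension of `g` is `m ↦ ∑ a • g (ε b m)`. Its `A`-linearity follows by
inserting `1 = ∑ a ε b` a second time, which turns the products that occur into elements of `ε A ε`,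
over which `g` is linear. -/
lemma cornerMap_surjective : Function.Surjective (h.cornerMap (M := M) (N := N)) := by
  intro g
  obtain ⟨T, a, ha⟩ := h.exists_sum_eq_one
  have hcorner (x : A) (m : h.Corner M) :
      h.incl (g (h.proj (x • h.incl m))) = (ε * x * ε) • h.incl (g m) := by
    have : h.proj (x • h.incl m) = h.compress x • m := h.incl_injective (by simp [mul_smul])
    rw [this, map_smul, incl_smul, map_compress]
  have hexp (x : A) (m : M) :
      h.proj (x • m) = ∑ b ∈ T, h.proj ((x * a b) • h.incl (h.proj (b • m))) := by
    apply h.incl_injective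
    simp only [map_sum, incl_proj]
    nth_rw 1 [← one_smul A m, ← ha]
    simp [Finset.sum_smul, Finset.smul_sum, mul_smul]
  -- For `x = 1` this says that the extension restricts to `g`; for general `x` it gives linearity.
  have hmain (x : A) (m : M) : ε • ∑ b ∈ T, (x * a b) • h.incl (g (h.proj (b • m))) =
      h.incl (g (h.proj (x • m))) := by
    rw [hexp x m, map_sum, map_sum, Finset.smul_sum]
    refine Finset.sum_congr rfl fun b _ => ?_
    rw [hcorner, mul_smul (ε * (x * a b)) ε, smul_incl, ← mul_smul]
  refine ⟨{ toFun := fun m => ∑ b ∈ T, a b • h.incl (g (h.proj (b • m)))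
            map_add' := fun m m' => by
              simp [smul_add, proj_add, Finset.sum_add_distrib]
            map_smul' := fun x m => ?_ }, ?_⟩
  · simp only [RingHom.id_apply, ← mul_smul, Finset.smul_sum]
    calc ∑ b ∈ T, a b • h.incl (g (h.proj ((b * x) • m)))
        = ∑ b ∈ T, ∑ b' ∈ T, (a b * ε * b * x * a b') • h.incl (g (h.proj (b' • m))) := by
          refine Finset.sum_congr rfl fun b _ => ?_
          rw [← hmain, Finset.smul_sum, Finset.smul_sum]
          refine Finset.sum_congr rfl fun b' _ => ?_
          simp only [mul_smul]
      _ = ∑ b' ∈ T, (x * a b') • h.incl (g (h.proj (b' • m))) := by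
          rw [Finset.sum_comm]
          refine Finset.sum_congr rfl fun b' _ => ?_
          rw [← Finset.sum_smul]
          simp only [mul_assoc _ x (a b')]
          rw [← Finset.sum_mul, ha, one_mul]
  · ext m
    apply h.incl_injective
    have h1 := hmain 1 (h.incl m)
    have h2 : h.proj (h.incl m) = m := h.incl_injective (by simp)
    simp only [one_mul, one_smul, h2] at h1
    exact (h.smul_incl _).symm.trans h1

end Corner

/-- The `A`-module `Hom_B(ε A, N)`. -/
def Coind (h : IsFullCorner ε φ) (N : Type*) [AddCommGroup N] [Module B N] : Type _ :=
  h.Corner A →ₗ[B] N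

/-! ### Coinduction, a right inverse of the corner functor up to isomorphism -/

section Coind

variable (h : IsFullCorner ε φ) {N : Type*} [AddCommGroup N] [Module B N]

instance : AddCommGroup (h.Coind N) := inferInstanceAs (AddCommGroup (h.Corner A →ₗ[B] N))

/-- Right multiplication on `ε A`. -/
def mulRight (a : A) : h.Corner A →ₗ[B] h.Corner A := h.cornerMap (LinearMap.toSpanSingleton A A a)

@[simp]
lemma incl_mulRight (a : A) (x : h.Corner A) : h.incl (h.mulRight a x) = h.incl x * a := rfl

instance : SMul A (h.Coind N) where
  smul a f := LinearMap.comp (M₁ := h.Corner A) f (h.mulRight a)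

/-- Evaluation of an element of `Hom_B(ε A, N)`. -/
def eval (f : h.Coind N) : h.Corner A →ₗ[B] N := f

lemma eval_injective : Function.Injective (h.eval (N := N)) := fun _ _ h => h

@[simp] lemma eval_add (f g : h.Coind N) : h.eval (f + g) = h.eval f + h.eval g := rfl

@[simp] lemma eval_zero : h.eval (0 : h.Coind N) = 0 := rfl

@[simp]
lemma eval_smul (a : A) (f : h.Coind N) (x : h.Corner A) :
    h.eval (a • f) x = h.eval f (h.mulRight a x) := rfl

instance : Module A (h.Coind N) where
  one_smul f := h.eval_injective (LinearMap.ext fun x => by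
    rw [eval_smul]; congr 1; exact h.incl_injective (by simp))
  mul_smul a b f := h.eval_injective (LinearMap.ext fun x => by
    simp only [eval_smul]; congr 1; exact h.incl_injective (by simp [mul_assoc]))
  smul_zero a := h.eval_injective (LinearMap.ext fun x => by simp)
  smul_add a f g := h.eval_injective (LinearMap.ext fun x => by simp)
  add_smul a b f := h.eval_injective (LinearMap.ext fun x => by
    simp only [eval_smul, eval_add, LinearMap.add_apply]
    rw [← map_add]; congr 1; exact h.incl_injective (by simp [mul_add]))
  zero_smul f := h.eval_injective (LinearMap.ext fun x => by
    simp only [eval_smul, eval_zero, LinearMap.zero_apply]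
    rw [← map_zero (h.eval f)]; congr 1; exact h.incl_injective (by simp))

/-- Every `B`-module is the corner of an `A`-module. -/
noncomputable def cornerCoind : h.Corner (h.Coind N) ≃ₗ[B] N :=
  LinearEquiv.ofBijective
    { toFun := fun f => h.eval (h.incl f) (h.mkCorner ε h.isIdempotentElem.eq)
      map_add' := fun f g => by simp
      map_smul' := fun b f => by
        rw [incl_smul, eval_smul, RingHom.id_apply, ← map_smul]
        congr 1
        exact h.incl_injective (by simp [h.left_mul, h.right_mul]) }
    ⟨by
      rw [injective_iff_map_eq_zero]
      intro f hf
      apply h.incl_injective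
      apply h.eval_injective
      ext x
      rw [← smul_incl, eval_smul]
      -- As `f` is fixed by `ε`, `f x = f (x ε) = (x ε) • f ε`, so `f` is determined by its value at
      -- `ε`.
      have : h.mulRight ε x = h.compress (h.incl x) • h.mkCorner ε h.isIdempotentElem.eq := by
        apply h.incl_injective
        have := h.smul_incl x
        rw [smul_eq_mul] at this
        simp [this, mul_assoc, h.isIdempotentElem.eq]
      rw [this, map_smul]
      have hf' : h.eval (h.incl f) (h.mkCorner ε h.isIdempotentElem.eq) = 0 := hf
      rw [hf', smul_zero]
      simp,
    by
      intro n
      have hcompress (x : h.Corner A) : φ (h.compress (h.incl x)) = h.incl x * ε := by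
        have := h.smul_incl x
        rw [smul_eq_mul] at this
        rw [map_compress, this]
      -- The preimage of `n` is `x ↦ (x ε) • n`, with `x ε ∈ ε A ε` read as an element of `B`.
      let f : h.Coind N := show h.Corner A →ₗ[B] N from
        { toFun := fun x => h.compress (h.incl x) • n
          map_add' := fun x y => by
            rw [← add_smul]; congr 1
            apply h.injective
            simp [mul_add, add_mul]
          map_smul' := fun b x => by
            rw [RingHom.id_apply, ← mul_smul]; congr 1
            apply h.injective
            rw [hcompress, incl_smul, map_mul, hcompress, smul_eq_mul, mul_assoc] }
      have hf : ∀ x, h.eval f x = h.compress (h.incl x) • n := fun x => rfl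
      refine ⟨h.mkCorner f (h.eval_injective (LinearMap.ext fun x => ?_)), ?_⟩
      · rw [eval_smul, hf, hf]
        congr 1
        apply h.injective
        rw [hcompress, hcompress, incl_mulRight, mul_assoc, h.isIdempotentElem.eq]
      · change h.eval f _ = n
        rw [hf]
        have : h.compress ε = 1 := h.injective (by
          rw [map_compress, h.apply_one, h.isIdempotentElem.eq, h.isIdempotentElem.eq])
        simp [this]⟩

end Coind

/-! ### The corner functor as a linear equivalence -/

section Functor

variable (h : IsFullCorner ε φ)

/-- The functor `M ↦ ε M`. -/
def cornerFunctor : ModuleCat.{u} A ⥤ ModuleCat.{u} B where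
  obj M := ModuleCat.of B (h.Corner M)
  map f := ModuleCat.ofHom (h.cornerMap f.hom)
  map_id _ := rfl
  map_comp _ _ := rfl

instance : h.cornerFunctor.Faithful where
  map_injective hfg := ModuleCat.hom_ext (h.cornerMap_injective
    (congrArg ModuleCat.Hom.hom hfg))

instance : h.cornerFunctor.Full where
  map_surjective g := by
    obtain ⟨f, hf⟩ := h.cornerMap_surjective g.hom
    exact ⟨ModuleCat.ofHom f, ModuleCat.hom_ext hf⟩

instance : h.cornerFunctor.EssSurj where
  mem_essImage N := ⟨ModuleCat.of A (h.Coind N), ⟨(h.cornerCoind (N := N)).toModuleIso⟩⟩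

instance : h.cornerFunctor.IsEquivalence where

instance : h.cornerFunctor.Additive where
  map_add := rfl

/-- A scalar `r` of `B` acts on a corner through `φ (r • 1) = r • ε`, and `ε` is the identity there.
-/
instance : h.cornerFunctor.Linear k where
  map_smul f r := by
    apply ModuleCat.hom_ext
    ext x
    apply h.incl_injective
    change algebraMap k A r • f.hom (h.incl x) =
      φ (algebraMap k B r) • f.hom (h.incl x)
    rw [Algebra.algebraMap_eq_smul_one, Algebra.algebraMap_eq_smul_one, map_smul, h.apply_one]
    nth_rw 1 [← h.smul_incl x]
    rw [map_smul, ← mul_smul, smul_mul_assoc, one_mul]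

end Functor

end IsFullCorner

/-! ### Comparison of the ordinary quivers -/

section Ext

/-- An equivalence of module categories, linear over the field, preserves the dimension of
`Ext¹`. -/
lemma rank_ext_eq_of_isEquivalence {k : Type w} {A B : Type u} [Field k] [Ring A] [Algebra k A]
    [Ring B] [Algebra k B] (F : ModuleCat.{u} A ⥤ ModuleCat.{u} B) [F.IsEquivalence] [F.Additive]
    [F.Linear k] (X Y : ModuleCat.{u} A) (n : ℕ) :
    Module.rank k (Abelian.Ext.{u} X Y n) = Module.rank k (Abelian.Ext.{u} (F.obj X) (F.obj Y) n) :=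
  (LinearEquiv.ofBijective (F.mapExtLinearMap k X Y n)
    (F.mapExt_bijective_of_preservesProjectiveObjects X Y n)).rank_eq

lemma rank_ext_le_of_iso {k : Type w} {A : Type u} [Field k] [Ring A] [Algebra k A]
    {X X' Y Y' : ModuleCat.{u} A} (f : X ≅ X') (g : Y ≅ Y') (n : ℕ) :
    Module.rank k (Abelian.Ext.{u} X Y n) ≤ Module.rank k (Abelian.Ext.{u} X' Y' n) := by
  let L : Abelian.Ext.{u} X Y n →ₗ[k] Abelian.Ext.{u} X' Y' n :=
    { toFun := fun α => ((Abelian.Ext.mk₀ f.inv).comp α (zero_add n)).comp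
        (Abelian.Ext.mk₀ g.hom) (add_zero n)
      map_add' := fun α β => by simp
      map_smul' := fun r α => by simp }
  refine LinearMap.rank_le_of_injective L fun α β h => ?_
  have key (α : Abelian.Ext.{u} X Y n) : ((Abelian.Ext.mk₀ f.hom).comp (L α) (zero_add n)).comp
        (Abelian.Ext.mk₀ g.inv) (add_zero n) = α := by
    simp [L]
  rw [← key α, ← key β, h]

lemma rank_ext_eq_of_iso {k : Type w} {A : Type u} [Field k] [Ring A] [Algebra k A]
    {X X' Y Y' : ModuleCat.{u} A} (f : X ≅ X') (g : Y ≅ Y') (n : ℕ) :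
    Module.rank k (Abelian.Ext.{u} X Y n) = Module.rank k (Abelian.Ext.{u} X' Y' n) :=
  le_antisymm (rank_ext_le_of_iso f g n) (rank_ext_le_of_iso f.symm g.symm n)

end Ext

namespace OrdinaryQuiver

variable {k : Type w} {A : Type u} [Field k] [Ring A] [Algebra k A]

instance (x : OrdinaryQuiver k A) : IsSimpleModule A x.simple :=
  (Quotient.out (s := SimpleMod.isoSetoid A) x).2

variable (k) in
lemma exists_simple_linearEquiv (S : Type u) [AddCommGroup S] [Module A S] [IsSimpleModule A S] :
    ∃ x : OrdinaryQuiver k A, Nonempty (x.simple ≃ₗ[A] S) := by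
  let S' : SimpleMod A := ⟨ModuleCat.of A S, inferInstanceAs (IsSimpleModule A S)⟩
  exact ⟨Quotient.mk (SimpleMod.isoSetoid A) S',
    Quotient.exact (s := SimpleMod.isoSetoid A) (Quotient.out_eq (s := SimpleMod.isoSetoid A) _)⟩

lemma eq_of_linearEquiv {x y : OrdinaryQuiver k A} (f : x.simple ≃ₗ[A] y.simple) : x = y := by
  rw [← Quotient.out_eq (s := SimpleMod.isoSetoid A) x,
    ← Quotient.out_eq (s := SimpleMod.isoSetoid A) y]
  exact Quotient.sound (s := SimpleMod.isoSetoid A) ⟨f⟩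

lemma mk_hom (x y : OrdinaryQuiver k A) : Cardinal.mk (x ⟶ y) = arrowCount x y :=
  Cardinal.mk_out _

end OrdinaryQuiver

lemma NaturalQuiver.mk_hom {A : Type u} [Ring A] (i j : NaturalQuiver A) :
    Cardinal.mk (i ⟶ j) = arrowCount i j :=
  Cardinal.mk_out _

namespace IsFullCorner

variable {k : Type w} {A B : Type u} [Field k] [Ring A] [Algebra k A] [Ring B]
    [Algebra k B] {ε : A} {φ : B →ₙₐ[k] A} (h : IsFullCorner ε φ)

instance (M : Type u) [AddCommGroup M] [Module A M] [IsSimpleModule A M] :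
    IsSimpleModule B (h.Corner M) :=
  IsSimpleModule.obj_of_isEquivalence h.cornerFunctor (ModuleCat.of A M)

lemma exists_corner_linearEquiv (N : Type u) [AddCommGroup N] [Module B N] [IsSimpleModule B N] :
    ∃ M : ModuleCat.{u} A, IsSimpleModule A M ∧ Nonempty (h.Corner M ≃ₗ[B] N) :=
  ⟨h.cornerFunctor.inv.obj (ModuleCat.of B N),
    IsSimpleModule.obj_of_isEquivalence h.cornerFunctor.inv (ModuleCat.of B N),
    ⟨(h.cornerFunctor.asEquivalence.counitIso.app (ModuleCat.of B N)).toLinearEquiv⟩⟩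

lemma nonempty_linearEquiv_of_corner {M N : Type u} [AddCommGroup M] [Module A M]
    [AddCommGroup N] [Module A N] (f : h.Corner M ≃ₗ[B] h.Corner N) : Nonempty (M ≃ₗ[A] N) :=
  ⟨(h.cornerFunctor.preimageIso (X := ModuleCat.of A M) (Y := ModuleCat.of A N)
    (LinearEquiv.toModuleIso f)).toLinearEquiv⟩

/-- The radical consists of the elements killing all simple modules. The simple `B`-modules are the
`ε M` with `M` simple, and `φ b` kills `M` exactly when `b` kills `ε M`, because `φ b = φ b * ε`. -/
lemma map_mem_jacobson_iff (h : IsFullCorner ε φ) {b : B} :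
    φ b ∈ Ring.jacobson A ↔ b ∈ Ring.jacobson B := by
  constructor
  · intro hb
    refine mem_jacobson_of_forall_isMaximal fun m hm s => ?_
    have := isSimpleModule_quotient hm
    obtain ⟨M, hM, ⟨f⟩⟩ := h.exists_corner_linearEquiv (B ⧸ m)
    obtain ⟨t, rfl⟩ := f.surjective s
    rw [← map_smul]
    convert map_zero f
    apply h.incl_injective
    rw [h.incl_smul, jacobson_smul_eq_zero hb, map_zero]
  · intro hb
    refine mem_jacobson_of_forall_isMaximal fun m hm s => ?_
    have := isSimpleModule_quotient hm
    have h1 := congrArg h.incl (jacobson_smul_eq_zero hb (h.proj s))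
    rwa [h.incl_smul, h.incl_proj, map_zero, ← mul_smul, h.right_mul] at h1

/-- The vertex of `Γ_B` corresponding to a vertex of `Γ_A`. -/
noncomputable def vertexMap (x : OrdinaryQuiver k A) : OrdinaryQuiver k B :=
  (OrdinaryQuiver.exists_simple_linearEquiv k (h.Corner x.simple)).choose

/-- The simple module at `h.vertexMap x` is the corner of the simple module at `x`. -/
noncomputable def vertexEquiv (x : OrdinaryQuiver k A) :
    (h.vertexMap x).simple ≃ₗ[B] h.Corner x.simple :=
  (OrdinaryQuiver.exists_simple_linearEquiv k (h.Corner x.simple)).choose_spec.some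

lemma vertexMap_bijective : Function.Bijective h.vertexMap := by
  constructor
  · intro x y hxy
    have f : (h.vertexMap x).simple ≃ₗ[B] (h.vertexMap y).simple := by rw [hxy]
    obtain ⟨g⟩ := h.nonempty_linearEquiv_of_corner
      ((h.vertexEquiv x).symm.trans (f.trans (h.vertexEquiv y)))
    exact OrdinaryQuiver.eq_of_linearEquiv g
  · intro y
    obtain ⟨M, hM, ⟨f⟩⟩ := h.exists_corner_linearEquiv y.simple
    obtain ⟨x, ⟨g⟩⟩ := OrdinaryQuiver.exists_simple_linearEquiv (A := A) k M
    let g' : h.Corner x.simple ≃ₗ[B] h.Corner M :=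
      (h.cornerFunctor.mapIso g.toModuleIso).toLinearEquiv
    exact ⟨x, OrdinaryQuiver.eq_of_linearEquiv ((h.vertexEquiv x).trans (g'.trans f))⟩

lemma arrowCount_vertexMap (x y : OrdinaryQuiver k A) :
    (h.vertexMap x).arrowCount (h.vertexMap y) = x.arrowCount y := by
  rw [OrdinaryQuiver.arrowCount, OrdinaryQuiver.arrowCount,
    rank_ext_eq_of_isEquivalence h.cornerFunctor]
  exact rank_ext_eq_of_iso (X' := h.cornerFunctor.obj x.simple) (Y' := h.cornerFunctor.obj y.simple)
    (h.vertexEquiv x).toModuleIso (h.vertexEquiv y).toModuleIso 1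

lemma isCornerOf_vertexMap {n : ℕ} {e : Fin n → A} (h : IsFullCorner (∑ i, e i) φ)
    (x : OrdinaryQuiver k A) : IsCornerOf e φ x (h.vertexMap x) := by
  refine ⟨h.incl.comp (h.vertexEquiv x).toLinearMap.toAddMonoidHom,
    h.incl_injective.comp (h.vertexEquiv x).injective, ?_, fun b t => ?_⟩
  · ext s
    constructor
    · rintro ⟨t, rfl⟩
      exact ⟨_, (h.smul_incl (h.vertexEquiv x t)).symm⟩
    · rintro ⟨t, rfl⟩
      obtain ⟨y, hy⟩ := (h.vertexEquiv x).surjective (h.proj t)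
      refine ⟨y, ?_⟩
      change h.incl (h.vertexEquiv x y) = _
      rw [hy, h.incl_proj]
  · change h.incl (h.vertexEquiv x (b • t)) = φ b • h.incl (h.vertexEquiv x t)
    rw [map_smul, h.incl_smul]

end IsFullCorner

/-! ### Morphisms of quivers from numbers of arrows -/

section Quivers

variable {V V' : Type*} [Quiver.{u} V] [Quiver.{u} V']

/-- Arrows carry no structure beyond their number, so any choice of bijections between arrow sets
will do. -/
lemma exists_prefunctor_isQuiverIso (F : V → V') (hF : Function.Bijective F)
    (h : ∀ x y, Cardinal.mk (F x ⟶ F y) = Cardinal.mk (x ⟶ y)) :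
    ∃ G : V ⥤q V', IsQuiverIso G ∧ G.obj = F := by
  let f x y : (x ⟶ y) ≃ (F x ⟶ F y) := (Cardinal.eq.1 (h x y).symm).some
  exact ⟨⟨F, fun {x y} => f x y⟩, ⟨hF, fun x y => (f x y).bijective⟩, rfl⟩

lemma exists_prefunctor_isDenseSubquiverEmbedding (F : V → V') (hF : Function.Bijective F)
    (h : ∀ x y, Cardinal.mk (x ⟶ y) ≤ Cardinal.mk (F x ⟶ F y))
    (h0 : ∀ x y, Cardinal.mk (x ⟶ y) = 0 → Cardinal.mk (F x ⟶ F y) = 0) :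
    ∃ G : V ⥤q V', IsDenseSubquiverEmbedding G ∧ G.obj = F := by
  let f x y : (x ⟶ y) ↪ (F x ⟶ F y) := ((Cardinal.le_def _ _).1 (h x y)).some
  refine ⟨⟨F, fun {x y} => f x y⟩, ⟨hF, fun x y => (f x y).injective, fun x y => ?_⟩, rfl⟩
  refine ⟨fun ⟨a⟩ => ⟨f x y a⟩, fun hne => ?_⟩
  rw [← Cardinal.mk_ne_zero_iff] at hne ⊢
  exact fun h => hne (h0 x y h)

end Quivers

/-! ### Vertices of the natural quiver -/

namespace NaturalQuiver

variable {k : Type w} {A : Type u} [Field k] [Ring A] [Algebra k A]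

variable (k) in
lemma exists_actsOn (i : NaturalQuiver A) : ∃ x : OrdinaryQuiver k A, ActsOn i x := by
  obtain ⟨m, hm, h⟩ := exists_isMaximal_actsNontrivially i.2.1
  have := isSimpleModule_quotient hm
  obtain ⟨x, ⟨f⟩⟩ := OrdinaryQuiver.exists_simple_linearEquiv (A := A) k (A ⧸ m)
  exact ⟨x, h.congr f.symm⟩

variable (k) in
/-- The vertex of the ordinary quiver corresponding to a vertex of the natural quiver. -/
noncomputable def toOrdinary (i : NaturalQuiver A) : OrdinaryQuiver k A :=
  (i.exists_actsOn k).choose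

lemma actsOn_toOrdinary (i : NaturalQuiver A) : ActsOn i (i.toOrdinary k) :=
  (i.exists_actsOn k).choose_spec

/-- Two minimal ideals acting on one simple module coincide; conversely each simple module has a
minimal ideal acting on it and on no other, so the simple module chosen for that ideal is the given
one. -/
lemma toOrdinary_bijective [FiniteDimensional k A] :
    Function.Bijective (toOrdinary k : NaturalQuiver A → OrdinaryQuiver k A) := by
  have := IsArtinianRing.of_finite k A
  constructor
  · intro i j hij
    have hj := j.actsOn_toOrdinary (k := k)
    rw [← hij] at hj
    exact Subtype.ext (eq_of_isAtom_of_actsNontrivially i.2 j.2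
      (i.actsOn_toOrdinary (k := k)) hj)
  · intro x
    obtain ⟨I, hI, hIx, huniq⟩ := exists_isAtom_actsNontrivially (R := A) x.simple
    obtain ⟨f⟩ := huniq (toOrdinary k ⟨I, hI⟩ : OrdinaryQuiver k A).simple
      (actsOn_toOrdinary (k := k) ⟨I, hI⟩)
    exact ⟨⟨I, hI⟩, OrdinaryQuiver.eq_of_linearEquiv f⟩

end NaturalQuiver

/-! ### Basic algebras over an algebraically closed field -/

/-- A complete set of pairwise inequivalent primitive orthogonal idempotents with sum `1`. -/
structure IsBasicDecomposition {B : Type u} [Ring B] {n : ℕ} (e : Fin n → B) : Prop where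
  primitive : ∀ i, IsPrimitiveIdempotent (e i)
  orthogonal : ∀ i j, i ≠ j → e i * e j = 0
  sum_eq_one : ∑ i, e i = 1
  eq_of_equivalent : ∀ i j (u v : B), u * v = e i → v * u = e j → e i * u = u → e j * v = v → i = j

/-- Everything about the `e i` is transported through `φ`. Non-isomorphism of the `A e i` becomes
inequivalence, a condition on elements of the corner alone that passes to `B`. -/
lemma IsBasicAlgebra.isBasicDecomposition {k : Type w} {A B : Type u} [Field k] [Ring A]
    [Algebra k A] [FiniteDimensional k A] [Ring B] [Algebra k B] {n : ℕ} {e : Fin n → A}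
    {φ : B →ₙₐ[k] A} (hB : IsBasicAlgebra e φ) :
    ∃ e' : Fin n → B, IsBasicDecomposition e' ∧ ∀ i, φ (e' i) = e i := by
  have h := hB.isFullCorner
  have hφ (i : Fin n) : φ (h.compress (e i)) = e i := by
    rw [h.map_compress, hB.idempotents.sum_mul, hB.idempotents.mul_sum]
  refine ⟨fun i => h.compress (e i), ⟨fun i => ⟨?_, fun h0 => ?_, ?_⟩, ?_, ?_, ?_⟩, hφ⟩
  · apply h.injective
    rw [map_mul, hφ]
    exact (hB.idempotents.primitive i).1
  · apply (hB.idempotents.primitive i).2.1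
    rw [← hφ, h0, map_zero]
  · intro g g' hg hg' hgg' hg'g hsum
    have key := (hB.idempotents.primitive i).2.2 (φ g) (φ g')
      (by rw [IsIdempotentElem, ← map_mul, hg.eq]) (by rw [IsIdempotentElem, ← map_mul, hg'.eq])
      (by rw [← map_mul, hgg', map_zero]) (by rw [← map_mul, hg'g, map_zero])
      (by rw [← map_add, ← hsum, hφ])
    rwa [map_eq_zero_iff _ h.injective, map_eq_zero_iff _ h.injective] at key
  · intro i j hij
    apply h.injective
    rw [map_mul, hφ, hφ, map_zero, hB.idempotents.orthogonal i j hij]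
  · apply h.injective
    rw [map_sum, h.apply_one]
    exact Finset.sum_congr rfl fun i _ => hφ i
  · intro i j u v huv hvu hu hv
    by_contra hij
    obtain ⟨ψ⟩ := nonempty_span_singleton_linearEquiv (e := e i) (f := e j) (u := φ u) (v := φ v)
      (by rw [← map_mul, huv, hφ]) (by rw [← map_mul, hvu, hφ])
      (by rw [← hφ, ← map_mul, hu]) (by rw [← hφ, ← map_mul, hv])
    exact (hB.idempotents.nonIso i j hij).false ψ

/-- Over an algebraically closed field, the corner of a primitive idempotent `e` consists of the
scalar multiples of `e` up to nilpotent elements. -/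
lemma IsPrimitiveIdempotent.exists_isNilpotent_sub {k : Type w} {B : Type u} [Field k]
    [IsAlgClosed k] [Ring B] [Algebra k B] [FiniteDimensional k B] {e : B}
    (he : IsPrimitiveIdempotent e) (b : B) : ∃ c : k, IsNilpotent (e * b * e - c • e) := by
  have hee : e * e = e := he.1
  let V : Submodule k B := LinearMap.range (LinearMap.mulLeft k e)
  have hV : ∀ v ∈ V, e * v = v := by
    rintro _ ⟨y, rfl⟩
    simp [← mul_assoc, hee]
  -- Left multiplication by `e b e` on `e B` has an eigenvalue `c`. Then `e b e - c e` kills a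
  -- nonzero vector, so it is not invertible in the corner and Fitting's lemma makes it nilpotent.
  let f : Module.End k V :=
    ((LinearMap.mulLeft k (e * b * e)).comp V.subtype).codRestrict V fun v =>
      ⟨b * e * v, by simp [mul_assoc]⟩
  have : Nontrivial V := ⟨⟨e, 1, by simp⟩, 0, fun h => he.2.1 (congrArg Subtype.val h)⟩
  obtain ⟨c, hc⟩ := Module.End.exists_eigenvalue f
  obtain ⟨v, hv⟩ := hc.exists_hasEigenvector
  refine ⟨c, (he.isNilpotent_or_exists_inverse (k := k) (by simp [mul_sub, ← mul_assoc, hee])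
    (by simp [sub_mul, mul_assoc, hee]) (Algebra.IsIntegral.isIntegral _)).resolve_right ?_⟩
  rintro ⟨d, -, hd⟩
  have h1 : (e * b * e) * (v : B) = c • (v : B) := congrArg Subtype.val hv.apply_eq_smul
  have h2 : (e * b * e - c • e) * (v : B) = 0 := by
    rw [sub_mul, h1, smul_mul_assoc, hV v v.2, sub_self]
  apply hv.2
  apply Subtype.ext
  rw [← hV v v.2, ← hd, mul_assoc, h2, mul_zero]
  rfl

namespace IsBasicDecomposition

variable {B : Type u} [Ring B] {n : ℕ} {e : Fin n → B}

lemma isIdempotentElem (he : IsBasicDecomposition e) (i : Fin n) : e i * e i = e i :=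
  (he.primitive i).1

lemma exists_smul_ne_zero (he : IsBasicDecomposition e) {S : Type*} [AddCommGroup S] [Module B S]
    [Nontrivial S] : ∃ i, ∃ s : S, e i • s ≠ 0 := by
  by_contra! h
  obtain ⟨s, hs⟩ := exists_ne (0 : S)
  apply hs
  rw [← one_smul B s, ← he.sum_eq_one, Finset.sum_smul]
  exact Finset.sum_eq_zero fun i _ => h i s

/-- If `e i` killed every `B ⧸ m`, then `1 - e i` would lie in no maximal left ideal and have a left
inverse, but `(1 - e i) * e i = 0`. -/
lemma exists_isMaximal (he : IsBasicDecomposition e) (i : Fin n) :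
    ∃ m : Ideal B, m.IsMaximal ∧ ∃ s : B ⧸ m, e i • s ≠ 0 := by
  by_contra! h
  have htop : Ideal.span {1 - e i} = ⊤ := by
    by_contra hne
    obtain ⟨m, hm, hle⟩ := Ideal.exists_le_maximal _ hne
    have h1 : e i • (Submodule.Quotient.mk 1 : B ⧸ m) = 0 := h m hm _
    rw [← Submodule.Quotient.mk_smul, smul_eq_mul, mul_one, Submodule.Quotient.mk_eq_zero] at h1
    refine hm.ne_top ((Ideal.eq_top_iff_one m).2 ?_)
    rw [← sub_add_cancel 1 (e i)]
    exact m.add_mem (hle (Ideal.mem_span_singleton_self _)) h1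
  obtain ⟨x, hx⟩ := Ideal.mem_span_singleton'.1 ((Ideal.eq_top_iff_one _).1 htop)
  apply (he.primitive i).2.1
  rw [← one_mul (e i), ← hx, mul_assoc, sub_mul, one_mul, he.isIdempotentElem, sub_self, mul_zero]

variable {k : Type w} [Field k] [Algebra k B]

/-- Primitive idempotents nonzero on one simple module are equivalent, and distinct members of a
basic decomposition are not. -/
lemma eq_of_smul_ne_zero (k : Type w) [Field k] [Algebra k B] [FiniteDimensional k B]
    (he : IsBasicDecomposition e) {S : Type*} [AddCommGroup S]
    [Module B S] [IsSimpleModule B S] {i j : Fin n} {s t : S} (hs : e i • s ≠ 0)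
    (ht : e j • t ≠ 0) : i = j := by
  obtain ⟨u, v, huv, hvu, hu, -, hv, -⟩ :=
    (he.primitive i).exists_mul_eq_of_smul_ne_zero k (he.primitive j) hs ht
  exact he.eq_of_equivalent i j u v huv hvu hu hv

lemma smul_eq_self (k : Type w) [Field k] [Algebra k B] [FiniteDimensional k B]
    (he : IsBasicDecomposition e) {S : Type*} [AddCommGroup S]
    [Module B S] [IsSimpleModule B S] {i : Fin n} {s : S} (hs : e i • s ≠ 0) (t : S) :
    e i • t = t := by
  nth_rw 2 [← one_smul B t]
  rw [← he.sum_eq_one, Finset.sum_smul, Finset.sum_eq_single i _ (by simp)]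
  intro j _ hj
  by_contra h
  exact hj (he.eq_of_smul_ne_zero k h hs)

variable [IsAlgClosed k] [FiniteDimensional k B]

variable (k) in
/-- The scalar by which an element of a basic algebra acts on the `i`-th simple module. -/
noncomputable def char (he : IsBasicDecomposition e) (i : Fin n) (b : B) : k :=
  ((he.primitive i).exists_isNilpotent_sub b).choose

/-- The nilpotent `ν = e i b e i - χ e i` acts on `S` as `b - χ`. If `ν • t ≠ 0`, some `d` returns
it to `t`, so `e i d ν` fixes `t`, is not nilpotent and is invertible in the corner. Then `ν` acts
injectively, which a nilpotent element cannot do. -/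
lemma smul_eq_char_smul (he : IsBasicDecomposition e) {S : Type*} [AddCommGroup S]
    [Module B S] [IsSimpleModule B S] {i : Fin n} {s : S} (hs : e i • s ≠ 0) (b : B) (t : S) :
    b • t = algebraMap k B (he.char k i b) • t := by
  have hself := he.smul_eq_self k hs
  obtain ⟨m, hm⟩ := ((he.primitive i).exists_isNilpotent_sub (k := k) b).choose_spec
  change (e i * b * e i - he.char k i b • e i) ^ m = 0 at hm
  set ν := e i * b * e i - he.char k i b • e i with hν
  have hνact (t : S) : ν • t = b • t - algebraMap k B (he.char k i b) • t := by
    rw [hν, sub_smul, mul_smul, mul_smul, hself, hself, Algebra.smul_def, mul_smul, hself]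
  by_contra hne
  have hw : ν • t ≠ 0 := by rwa [hνact, sub_ne_zero]
  obtain ⟨d, hd⟩ := exists_smul_eq_of_ne_zero (R := B) hw t
  have ht : t ≠ 0 := fun h => hw (by rw [h, smul_zero])
  have heν : e i * ν = ν := by
    simp [hν, mul_sub, ← mul_assoc, he.isIdempotentElem]
  have hνe : ν * e i = ν := by
    simp [hν, sub_mul, mul_assoc, he.isIdempotentElem]
  have hfix : (e i * d * ν) • t = t := by rw [mul_smul, mul_smul, hd, hself]
  rcases (he.primitive i).isNilpotent_or_exists_inverse (k := k) (c := e i * d * ν)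
    (by simp [← mul_assoc, he.isIdempotentElem]) (by rw [mul_assoc, hνe])
    (Algebra.IsIntegral.isIntegral _) with ⟨l, hl⟩ | ⟨x, -, hx⟩
  · have : ∀ l : ℕ, (e i * d * ν) ^ l • t = t := fun l => by
      induction l with
      | zero => simp
      | succ l ih => rw [pow_succ, mul_smul, hfix, ih]
    exact ht (by rw [← this l, hl, zero_smul])
  · have hinj (t : S) (h : ν • t = 0) : t = 0 := by
      rw [← hself t, ← hx, mul_smul, mul_smul, h, smul_zero, smul_zero]
    have : ∀ l : ℕ, ν ^ l • t ≠ 0 := fun l => by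
      induction l with
      | zero => simpa using ht
      | succ l ih =>
        rw [pow_succ', mul_smul]
        exact fun h => ih (hinj _ h)
    exact this m (by rw [hm, zero_smul])

lemma smul_eq_zero_iff (he : IsBasicDecomposition e) {S : Type*} [AddCommGroup S]
    [Module B S] [IsSimpleModule B S] {i : Fin n} {s t : S} (hs : e i • s ≠ 0) (ht : t ≠ 0) (b : B) :
    b • t = 0 ↔ he.char k i b = 0 := by
  rw [he.smul_eq_char_smul (k := k) hs]
  constructor
  · intro h
    by_contra h0
    apply ht
    rw [← one_smul B t, ← map_one (algebraMap k B), ← inv_mul_cancel₀ h0, map_mul, mul_smul, h,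
      smul_zero]
  · intro h
    rw [h, map_zero, zero_smul]

/-- On a simple module where `e i` is nonzero, both `b` and the sum act as the `i`-th scalar, so the
difference kills all simple modules. Hence the `e j` span `B/r`. -/
lemma sub_sum_char_mem_jacobson (he : IsBasicDecomposition e) (b : B) :
    b - ∑ j, he.char k j b • e j ∈ Ring.jacobson B := by
  refine mem_jacobson_of_forall_isMaximal fun m hm s => ?_
  have := isSimpleModule_quotient hm
  have := IsSimpleModule.nontrivial B (B ⧸ m)
  obtain ⟨i, t, ht⟩ := he.exists_smul_ne_zero (S := B ⧸ m)
  rw [sub_smul, Finset.sum_smul, Finset.sum_eq_single i _ (by simp),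
    he.smul_eq_char_smul (k := k) ht, Algebra.smul_def, mul_smul, he.smul_eq_self k ht, sub_self]
  intro j _ hj
  rw [Algebra.smul_def, mul_smul]
  by_contra h
  exact hj (he.eq_of_smul_ne_zero k (s := s) (fun h0 => h (by rw [h0, smul_zero])) ht)

end IsBasicDecomposition

/-! ### The natural quiver of a basic algebra -/

section ArrowSpace

variable {B : Type u} [Ring B]

lemma mul_mem_jacobson_sq {x y : B} (hx : x ∈ Ring.jacobson B) (hy : y ∈ Ring.jacobson B) :
    x * y ∈ Ring.jacobson B ^ 2 := by
  rw [Submodule.pow_succ, Submodule.pow_one]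
  exact Submodule.mul_mem_mul hx hy

lemma jacobson_sq_induction {p : B → Prop} {x : B} (hx : x ∈ Ring.jacobson B ^ 2)
    (hmul : ∀ y ∈ Ring.jacobson B, ∀ z ∈ Ring.jacobson B, p (y * z))
    (hadd : ∀ y z, p y → p z → p (y + z)) : p x := by
  rw [Submodule.pow_succ, Submodule.pow_one] at hx
  exact Submodule.mul_induction_on hx hmul hadd

lemma mul_mem_jacobson_sq_left (a : B) {x : B} (hx : x ∈ Ring.jacobson B ^ 2) :
    a * x ∈ Ring.jacobson B ^ 2 := Ideal.mul_mem_left _ a hx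

lemma mul_mem_jacobson_sq_right (a : B) {x : B} (hx : x ∈ Ring.jacobson B ^ 2) :
    x * a ∈ Ring.jacobson B ^ 2 := Ideal.mul_mem_right a _ hx

/-- The image of `e r f` in `B/r²`, where `r` is the radical of `B`. -/
def arrowSpace (k : Type w) [Field k] [Algebra k B] (e f : B) :
    Submodule k (B ⧸ Ring.jacobson B ^ 2) :=
  ((Ring.jacobson B).restrictScalars k).map
    ((Ideal.Quotient.mkₐ k (Ring.jacobson B ^ 2)).toLinearMap ∘ₗ LinearMap.mulLeft k e ∘ₗ
      LinearMap.mulRight k f)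

lemma mem_arrowSpace {k : Type w} [Field k] [Algebra k B] {e f : B}
    {m : B ⧸ Ring.jacobson B ^ 2} : m ∈ arrowSpace k e f ↔
      ∃ x ∈ Ring.jacobson B, Ideal.Quotient.mk (Ring.jacobson B ^ 2) (e * x * f) = m := by
  simp [arrowSpace, mul_assoc]

/-- The error `a - c • e` is in the radical, so its product with another radical element vanishes
modulo `r²`. -/
lemma mk_mul_of_mem_arrowSpace {k : Type w} [Field k] [Algebra k B] {e f : B}
    (he : e * e = e) {m : B ⧸ Ring.jacobson B ^ 2} (hm : m ∈ arrowSpace k e f) {a : B} {c : k}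
    (ha : a - c • e ∈ Ring.jacobson B) : Ideal.Quotient.mk (Ring.jacobson B ^ 2) a * m = c • m := by
  obtain ⟨x, hx, rfl⟩ := mem_arrowSpace.1 hm
  rw [← map_mul]
  change _ = c • Ideal.Quotient.mkₐ k (Ring.jacobson B ^ 2) (e * x * f)
  rw [← map_smul]
  refine Ideal.Quotient.eq.2 ?_
  have : a * (e * x * f) - c • (e * x * f) = (a - c • e) * (e * x) * f := by
    simp [sub_mul, ← mul_assoc, he]
  rw [this]
  exact mul_mem_jacobson_sq_right _ (mul_mem_jacobson_sq ha (Ideal.mul_mem_left _ _ hx))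

lemma mul_mk_of_mem_arrowSpace {k : Type w} [Field k] [Algebra k B] {e f : B}
    (hf : f * f = f) {m : B ⧸ Ring.jacobson B ^ 2} (hm : m ∈ arrowSpace k e f) {a : B} {c : k}
    (ha : a - c • f ∈ Ring.jacobson B) : m * Ideal.Quotient.mk (Ring.jacobson B ^ 2) a = c • m := by
  obtain ⟨x, hx, rfl⟩ := mem_arrowSpace.1 hm
  rw [← map_mul]
  change _ = c • Ideal.Quotient.mkₐ k (Ring.jacobson B ^ 2) (e * x * f)
  rw [← map_smul]
  refine Ideal.Quotient.eq.2 ?_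
  have : e * x * f * a - c • (e * x * f) = e * (x * f * (a - c • f)) := by
    simp [mul_sub, mul_assoc, hf]
  rw [this]
  exact mul_mem_jacobson_sq_left _ (mul_mem_jacobson_sq (Ideal.mul_mem_right _ _ hx) ha)

lemma sInf_mk_span_eq_rank {k : Type w} {M : Type u} [Field k] [AddCommGroup M] [Module k M]
    (W : Submodule k M) :
    sInf {c | ∃ X : Set M, Submodule.span k X = W ∧ Cardinal.mk X = c} = Module.rank k W := by
  apply le_antisymm
  · let b := Module.Basis.ofVectorSpace k W
    refine csInf_le' ⟨Set.range fun i => (b i : M), ?_, ?_⟩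
    · rw [Set.range_comp' Subtype.val b]
      change Submodule.span k (W.subtype '' Set.range b) = W
      rw [← Submodule.map_span, b.span_eq, Submodule.map_subtype_top]
    · rw [Cardinal.mk_range_eq (fun i => (b i : M)) (Subtype.val_injective.comp b.injective),
        b.mk_eq_rank'']
  · refine le_csInf ⟨_, W, Submodule.span_eq W, rfl⟩ ?_
    rintro _ ⟨X, rfl, rfl⟩
    exact rank_span_le X

lemma arrowBimodule_eq_arrowSpace {k : Type w} [Field k] [Algebra k B] {e f : B}
    {I J : TwoSidedIdeal (B ⧸ Ring.jacobson B)}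
    (hI : ∀ b, Ideal.Quotient.mk (Ring.jacobson B) b ∈ I ↔ ∃ c : k, b - c • e ∈ Ring.jacobson B)
    (hJ : ∀ b, Ideal.Quotient.mk (Ring.jacobson B) b ∈ J ↔ ∃ c : k, b - c • f ∈ Ring.jacobson B) :
    arrowBimodule I J = (arrowSpace k e f).toAddSubgroup := by
  apply le_antisymm
  · refine (AddSubgroup.closure_le _).2 ?_
    rintro _ ⟨a, x, b, ha, hx, hb, rfl⟩
    obtain ⟨c, hc⟩ := (hI a).1 ha
    obtain ⟨d, hd⟩ := (hJ b).1 hb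
    -- Modulo the radical `a` is `c • e` and `b` is `d • f`, which yields the scalar `d * c`.
    refine mem_arrowSpace.2 ⟨(d * c) • x, ?_, ?_⟩
    · exact ((Ring.jacobson B).restrictScalars k).smul_mem _ hx
    · refine (Ideal.Quotient.eq.2 ?_).symm
      have : a * x * b - e * ((d * c) • x) * f =
          (a - c • e) * x * b + (c • e) * (x * (b - d • f)) := by
        simp only [sub_mul, mul_sub, mul_smul_comm, smul_mul_assoc, mul_assoc, smul_smul]
        abel
      rw [this]
      exact Ideal.add_mem _ (mul_mem_jacobson_sq_right _ (mul_mem_jacobson_sq hc hx))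
        (mul_mem_jacobson_sq_left _ (mul_mem_jacobson_sq hx hd))
  · intro m hm
    obtain ⟨x, hx, rfl⟩ := mem_arrowSpace.1 hm
    exact AddSubgroup.subset_closure ⟨e, x, f, (hI e).2 ⟨1, by simp⟩, hx, (hJ f).2 ⟨1, by simp⟩, rfl⟩

/-- If `I` and `J` are spanned over the field by the idempotents `e` and `f`, then the rank of
`I · r/r² · J` is the dimension of `e · r/r² · f`. -/
lemma arrowBimoduleRank_eq_rank_arrowSpace {k : Type w} [Field k] [Algebra k B] {e f : B}
    (he : e * e = e) (hf : f * f = f) {I J : TwoSidedIdeal (B ⧸ Ring.jacobson B)}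
    (hI : ∀ b, Ideal.Quotient.mk (Ring.jacobson B) b ∈ I ↔ ∃ c : k, b - c • e ∈ Ring.jacobson B)
    (hJ : ∀ b, Ideal.Quotient.mk (Ring.jacobson B) b ∈ J ↔ ∃ c : k, b - c • f ∈ Ring.jacobson B) :
    arrowBimoduleRank I J = Module.rank k (arrowSpace k e f) := by
  rw [← sInf_mk_span_eq_rank, arrowBimoduleRank]
  congr 1
  ext c
  refine exists_congr fun X => and_congr_left fun _ => ?_
  rw [GeneratesArrowBimodule, arrowBimodule_eq_arrowSpace hI hJ]
  -- Both ideals act on `e (r/r²) f` through scalars, so sub-bimodules are the same as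
  -- `k`-subspaces.
  constructor
  · rintro ⟨hX, hgen⟩
    have hle : Submodule.span k X ≤ arrowSpace k e f := Submodule.span_le.2 hX
    refine Submodule.toAddSubgroup_injective (hgen (Submodule.span k X).toAddSubgroup hle
      Submodule.subset_span ?_ ?_)
    · intro a ha m hm
      obtain ⟨c, hc⟩ := (hI a).1 ha
      rw [mk_mul_of_mem_arrowSpace he (hle hm) hc]
      exact (Submodule.span k X).smul_mem c hm
    · intro a ha m hm
      obtain ⟨c, hc⟩ := (hJ a).1 ha
      rw [mul_mk_of_mem_arrowSpace hf (hle hm) hc]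
      exact (Submodule.span k X).smul_mem c hm
  · intro hX
    refine ⟨fun x hx => ?_, fun N hN hXN hl _ => le_antisymm hN ?_⟩
    · rw [← hX]
      exact Submodule.subset_span hx
    · let N' : Submodule k (B ⧸ Ring.jacobson B ^ 2) :=
        { N with
          smul_mem' := fun c m hm => by
            have h0 : c • e - c • e ∈ Ring.jacobson B := by simp
            rw [← mk_mul_of_mem_arrowSpace he (hN hm) h0]
            exact hl _ ((hI _).2 ⟨c, h0⟩) m hm }
      have : arrowSpace k e f ≤ N' := by
        rw [← hX]
        exact Submodule.span_le.2 hXN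
      exact this

end ArrowSpace

namespace IsBasicDecomposition

variable {k : Type w} {B : Type u} [Field k] [Ring B] [Algebra k B] {n : ℕ} {e : Fin n → B}
  [IsAlgClosed k] [FiniteDimensional k B]

/-- The minimal ideals of a basic algebra modulo its radical are spanned by the images of primitive
idempotents. -/
lemma mk_mem_iff (he : IsBasicDecomposition e) {I : TwoSidedIdeal (B ⧸ Ring.jacobson B)}
    (hI : IsAtom I) {S : Type u} [AddCommGroup S] [Module B S] [IsSimpleModule B S]
    (hIS : ActsNontrivially I S) {i : Fin n} {s : S} (hs : e i • s ≠ 0) (b : B) :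
    Ideal.Quotient.mk (Ring.jacobson B) b ∈ I ↔ ∃ c : k, b - c • e i ∈ Ring.jacobson B := by
  have := IsArtinianRing.of_finite k B
  have hsmul (c : k) (x : B) (hx : Ideal.Quotient.mk (Ring.jacobson B) x ∈ I) :
      Ideal.Quotient.mk (Ring.jacobson B) (c • x) ∈ I := by
    rw [Algebra.smul_def, map_mul]
    exact I.mul_mem_left _ _ hx
  have key (b : B) (hb : Ideal.Quotient.mk (Ring.jacobson B) b ∈ I) :
      b - he.char k i b • e i ∈ Ring.jacobson B := by
    have h1 := he.sub_sum_char_mem_jacobson (k := k) b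
    rwa [Finset.sum_eq_single i _ (by simp)] at h1
    -- For `j ≠ i` a simple module on which `e j` is nonzero is not isomorphic to `S`, so `I` kills
    -- it and the `j`-th scalar of `b` vanishes.
    intro j _ hj
    obtain ⟨m, hm, t, ht⟩ := he.exists_isMaximal j
    have := isSimpleModule_quotient hm
    have ht0 : t ≠ 0 := fun h => ht (by rw [h, smul_zero])
    rw [(he.smul_eq_zero_iff (k := k) ht ht0 b).1, zero_smul]
    by_contra hbt
    obtain ⟨f⟩ := nonempty_linearEquiv_of_actsNontrivially hI S (B ⧸ m) hIS ⟨b, hb, t, hbt⟩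
    refine hj (he.eq_of_smul_ne_zero k (s := f t) (t := s) ?_ hs)
    rw [← map_smul]
    exact fun h => ht (f.map_eq_zero_iff.1 h)
  constructor
  · exact fun hb => ⟨_, key b hb⟩
  · rintro ⟨c, hc⟩
    obtain ⟨a, ha, t, ht⟩ := hIS
    have ht0 : t ≠ 0 := fun h => ht (by rw [h, smul_zero])
    have hne : he.char k i a ≠ 0 := fun h => ht ((he.smul_eq_zero_iff hs ht0 a).2 h)
    have h1 : Ideal.Quotient.mk (Ring.jacobson B) (e i) ∈ I := by
      have h2 : Ideal.Quotient.mk (Ring.jacobson B) (he.char k i a • e i) ∈ I := by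
        rwa [← Ideal.Quotient.eq.2 (key a ha)]
      have h3 := hsmul (he.char k i a)⁻¹ _ h2
      rwa [smul_smul, inv_mul_cancel₀ hne, one_smul] at h3
    rw [Ideal.Quotient.eq.2 hc]
    exact hsmul c _ h1

end IsBasicDecomposition

/-! ### The ordinary quiver of a basic algebra -/

/-- If `0 → K → P → S → 0` is exact with `P` projective and every map from `P` to `T` vanishes on
`K`, then the connecting map identifies `Hom(K, T)` with `Ext¹(S, T)`. -/
lemma extClass_comp_bijective {A : Type u} [Ring A] {E : ShortComplex (ModuleCat.{u} A)}
    (hE : E.ShortExact) [Projective E.X₂] {T : ModuleCat.{u} A} (hT : ∀ f : E.X₂ ⟶ T, E.f ≫ f = 0) :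
    Function.Bijective fun g : E.X₁ ⟶ T =>
      hE.extClass.comp (Abelian.Ext.mk₀ g) (add_zero 1) := by
  constructor
  · intro g g' hgg'
    have h0 : hE.extClass.comp (Abelian.Ext.mk₀ (g - g')) (add_zero 1) = 0 := by
      rw [sub_eq_add_neg, Abelian.Ext.mk₀_add, Abelian.Ext.mk₀_neg, Abelian.Ext.comp_add,
        Abelian.Ext.comp_neg, ← sub_eq_add_neg, sub_eq_zero]
      exact hgg'
    obtain ⟨x, hx⟩ := Abelian.Ext.contravariant_sequence_exact₁ hE T _ (add_zero 1) h0
    obtain ⟨f, rfl⟩ := (Abelian.Ext.mk₀_bijective _ _).2 x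
    rw [Abelian.Ext.mk₀_comp_mk₀, hT] at hx
    exact (sub_eq_zero.1 ((Abelian.Ext.mk₀_bijective _ _).1 hx).symm)
  · intro x
    obtain ⟨y, hy⟩ := Abelian.Ext.contravariant_sequence_exact₃ hE T x
      (Abelian.Ext.eq_zero_of_projective _) (add_zero 1)
    obtain ⟨g, rfl⟩ := (Abelian.Ext.mk₀_bijective _ _).2 y
    exact ⟨g, hy⟩

lemma projective_span_singleton {A : Type u} [Ring A] {e : A} (he : e * e = e) :
    Module.Projective A (Ideal.span {e}) := by
  refine Module.Projective.of_split (Ideal.span {e}).subtype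
    ((LinearMap.toSpanSingleton A A e).codRestrict (Ideal.span {e}) fun x =>
      Ideal.mem_span_singleton'.2 ⟨x, rfl⟩) ?_
  ext x
  obtain ⟨y, hy⟩ := Ideal.mem_span_singleton'.1 x.2
  simp [← hy, mul_assoc, he]

namespace IsBasicDecomposition

variable {k : Type w} {B : Type u} [Field k] [Ring B] [Algebra k B] {n : ℕ} {e : Fin n → B}
  [IsAlgClosed k] [FiniteDimensional k B]

lemma mul_sub_char_mem_jacobson (he : IsBasicDecomposition e) (i : Fin n) (b : B) :
    e i * b - he.char k i b • e i ∈ Ring.jacobson B := by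
  have h := Ideal.mul_mem_left _ (e i) (he.sub_sum_char_mem_jacobson (k := k) b)
  rwa [mul_sub, Finset.mul_sum, Finset.sum_eq_single i, mul_smul_comm, he.isIdempotentElem] at h
  · intro j _ hj
    rw [mul_smul_comm, he.orthogonal i j hj.symm, smul_zero]
  · simp

/-- In a basic algebra, `Ext¹(S, T)` for the simple modules `S` and `T` belonging to the
idempotents `e j` and `e i` has the dimension of `e i · r/r² · e j`. -/
lemma rank_ext_eq_rank_arrowSpace (he : IsBasicDecomposition e) (S T : ModuleCat.{u} B)
    [IsSimpleModule B S] [IsSimpleModule B T] {i j : Fin n} {s : S} {t : T} (hs : e j • s ≠ 0)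
    (ht : e i • t ≠ 0) :
    Module.rank k (Abelian.Ext.{u} S T 1) = Module.rank k (arrowSpace k (e i) (e j)) := by
  have ht0 : t ≠ 0 := fun h => ht (by rw [h, smul_zero])
  let P : Ideal B := Ideal.span {e j}
  have hP (x : P) : (x : B) * e j = x := by
    obtain ⟨y, hy⟩ := Ideal.mem_span_singleton'.1 x.2
    rw [← hy, mul_assoc, he.isIdempotentElem]
  let π : P →ₗ[B] S := (LinearMap.toSpanSingleton B S (e j • s)).comp P.subtype
  have hπ : Function.Surjective π := LinearMap.surjective_of_ne_zero fun h => hs (by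
    have := LinearMap.congr_fun h ⟨e j, Ideal.mem_span_singleton_self _⟩
    simpa [π, smul_smul, he.isIdempotentElem] using this)
  let E := π.shortComplexKer
  have hE : E.ShortExact := LinearMap.shortExact_shortComplexKer hπ
  have : Module.Projective B P := projective_span_singleton (he.isIdempotentElem j)
  have : Projective E.X₂ := inferInstanceAs (Projective (ModuleCat.of B P))
  -- `K` is `r e j`: its elements have `j`-th scalar `0` and are fixed by right multiplication by `e
  -- j`, hence lie in the radical; the reverse inclusion is `hKmk`.
  let K := LinearMap.ker π
  have hK (x : K) : (x : B) ∈ Ring.jacobson B := by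
    have h1 : (x : B) • e j • s = 0 := x.2
    have h2 : he.char k j (x : B) = 0 := by rwa [he.smul_eq_zero_iff (k := k) hs hs] at h1
    have h3 := Ideal.mul_mem_right (e j) _ (he.sub_sum_char_mem_jacobson (k := k) (x : B))
    rwa [sub_mul, hP, Finset.sum_mul, Finset.sum_eq_single j, h2, zero_smul, zero_mul, sub_zero]
      at h3
    · intro l _ hl
      rw [smul_mul_assoc, he.orthogonal l j hl, smul_zero]
    · simp
  have hKmk (x : B) (hx : x ∈ Ring.jacobson B) : ∃ y : K, (y : B) = x * e j :=
    ⟨⟨⟨x * e j, Ideal.mem_span_singleton'.2 ⟨x, rfl⟩⟩, jacobson_smul_eq_zero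
      (Ideal.mul_mem_right _ _ hx) _⟩, rfl⟩
  have hT (f : E.X₂ ⟶ T) : E.f ≫ f = 0 := by
    ext x
    let g : P →ₗ[B] T := f.hom
    let x' : K := x
    change g x'.1 = 0
    have : x'.1 = (x' : B) • (⟨e j, Ideal.mem_span_singleton_self _⟩ : P) :=
      Subtype.ext (hP x'.1).symm
    rw [this, map_smul, jacobson_smul_eq_zero (hK x')]
  let W := arrowSpace k (e i) (e j)
  -- Left multiplication by `e i` modulo `r²`. It is onto, and every `K → T` factors through it,
  -- which identifies `Hom_B(K, T)` with `Hom_k(W, T)`.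
  let q (x : K) : W := ⟨Ideal.Quotient.mk _ (e i * (x : B)),
    mem_arrowSpace.2 ⟨x, hK x, by rw [mul_assoc, hP]⟩⟩
  have hq_add (x y : K) : q (x + y) = q x + q y := Subtype.ext (by simp [q, mul_add])
  have hq_smul (b : B) (c : k) (hb : e i * b - c • e i ∈ Ring.jacobson B) (x : K) :
      q (b • x) = c • q x := by
    apply Subtype.ext
    change Ideal.Quotient.mk _ (e i * (b * (x : B))) =
      c • Ideal.Quotient.mkₐ k (Ring.jacobson B ^ 2) (e i * x)
    rw [← map_smul]
    refine Ideal.Quotient.eq.2 ?_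
    have h1 : e i * (b * (x : B)) - c • (e i * (x : B)) = (e i * b - c • e i) * x := by
      rw [sub_mul, mul_assoc, smul_mul_assoc]
    rw [h1]
    exact mul_mem_jacobson_sq hb (hK x)
  have hq_surj : Function.Surjective q := by
    rintro ⟨m, hm⟩
    obtain ⟨x, hx, rfl⟩ := mem_arrowSpace.1 hm
    obtain ⟨y, hy⟩ := hKmk x hx
    exact ⟨y, Subtype.ext (by simp only [q, hy, mul_assoc])⟩
  have hq_ker (g : K →ₗ[B] T) (x y : K) (hxy : q x = q y) : g x = g y := by
    have h1 : e i * (x : B) - e i * y ∈ Ring.jacobson B ^ 2 :=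
      Ideal.Quotient.eq.1 (congrArg Subtype.val hxy)
    -- For `z = a * b` with `a`, `b` in the radical, `b * e j` is in `K` and `g (a • b e j) = a • g
    -- (b e j) = 0`, as the radical kills `T`.
    have h2 (z : B) (hz : z ∈ Ring.jacobson B ^ 2) : ∃ u : K, (u : B) = z * e j ∧ g u = 0 := by
      refine jacobson_sq_induction (p := fun z => ∃ u : K, (u : B) = z * e j ∧ g u = 0) hz
        (fun a ha b hb => ?_) ?_
      · obtain ⟨y, hy⟩ := hKmk b hb
        refine ⟨a • y, ?_, by rw [map_smul, jacobson_smul_eq_zero ha]⟩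
        change a * (y : B) = _
        rw [hy, mul_assoc]
      · rintro a b ⟨u, hu, hgu⟩ ⟨v, hv, hgv⟩
        refine ⟨u + v, ?_, by rw [map_add, hgu, hgv, add_zero]⟩
        change (u : B) + (v : B) = _
        rw [hu, hv, add_mul]
    obtain ⟨u, hu, hgu⟩ := h2 _ h1
    have h3 : e i • (x - y) = u := by
      apply Subtype.ext
      apply Subtype.ext
      change e i * ((x : B) - y) = u
      rw [hu, sub_mul, mul_assoc, mul_assoc, hP, hP, mul_sub]
    rwa [← h3, map_smul, he.smul_eq_self k ht, map_sub, sub_eq_zero] at hgu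
  -- Composition with `q` is `B`-linear because `b` acts on `T`, and through `q` on `W`, by the same
  -- `i`-th scalar.
  let Φ (ω : W →ₗ[k] T) : K →ₗ[B] T :=
    { toFun := fun x => ω (q x)
      map_add' := fun x y => by rw [hq_add, map_add]
      map_smul' := fun b x => by
        rw [hq_smul b _ (he.mul_sub_char_mem_jacobson i b), map_smul, RingHom.id_apply,
          he.smul_eq_char_smul (k := k) ht b]
        rfl }
  have hΦ : Function.Bijective Φ := by
    constructor
    · intro ω ω' h
      ext w
      obtain ⟨x, rfl⟩ := hq_surj w
      exact LinearMap.congr_fun h x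
    · intro g
      have hσ := Function.surjInv_eq hq_surj
      refine ⟨{ toFun := fun w => g (Function.surjInv hq_surj w)
                map_add' := fun w w' => ?_
                map_smul' := fun c w => ?_ }, ?_⟩
      · rw [← map_add]
        exact hq_ker g _ _ (by rw [hσ, hq_add, hσ, hσ])
      · change _ = algebraMap k B c • g _
        rw [← map_smul]
        refine hq_ker g _ _ ?_
        rw [hσ, hq_smul _ c, hσ]
        rw [← Algebra.commutes, ← Algebra.smul_def, sub_self]
        exact zero_mem _
      · ext x
        exact hq_ker g _ _ (hσ _)
  let Ψ : (W →ₗ[k] T) →ₗ[k] Abelian.Ext.{u} S T 1 :=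
    { toFun := fun ω => hE.extClass.comp (Abelian.Ext.mk₀ (ModuleCat.ofHom (Φ ω) : E.X₁ ⟶ T))
        (add_zero 1)
      map_add' := fun ω ω' => by
        rw [← Abelian.Ext.comp_add, ← Abelian.Ext.mk₀_add]
        rfl
      map_smul' := fun c ω => by
        rw [RingHom.id_apply, ← Abelian.Ext.comp_smul, ← Abelian.Ext.mk₀_smul]
        rfl }
  have hΨ : Function.Bijective Ψ := by
    refine (extClass_comp_bijective hE hT).comp (f := fun ω => (ModuleCat.ofHom (Φ ω) : E.X₁ ⟶ T))
      ⟨fun ω ω' h => hΦ.1 (congrArg ModuleCat.Hom.hom h), fun g => ?_⟩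
    obtain ⟨ω, hω⟩ := hΦ.2 g.hom
    exact ⟨ω, ModuleCat.hom_ext hω⟩
  rw [← (LinearEquiv.ofBijective Ψ hΨ).rank_eq]
  -- `B` acts on `T` by scalars, so `T` is a line and `Hom_k(W, T)` has the dimension of `W`.
  have hT1 : Module.finrank k T = 1 := by
    refine finrank_eq_one t ht0 fun t' => ?_
    obtain ⟨b, rfl⟩ := exists_smul_eq_of_ne_zero (R := B) ht0 t'
    exact ⟨he.char k i b, (he.smul_eq_char_smul (k := k) ht b t).symm⟩
  have : FiniteDimensional k T := Module.finite_of_finrank_eq_succ hT1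
  rw [← Module.finrank_eq_rank, ← Module.finrank_eq_rank, Module.finrank_linearMap, hT1, mul_one]

end IsBasicDecomposition

/-! ### Comparison of the natural quivers -/

section Generators

variable {A : Type u} [Ring A]

lemma exists_generatesArrowBimodule (I J : TwoSidedIdeal (A ⧸ Ring.jacobson A)) :
    ∃ X : Set (A ⧸ Ring.jacobson A ^ 2),
      GeneratesArrowBimodule I J X ∧ Cardinal.mk X = arrowBimoduleRank I J :=
  csInf_mem (s := {c | ∃ X : Set (A ⧸ Ring.jacobson A ^ 2),
    GeneratesArrowBimodule I J X ∧ Cardinal.mk X = c})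
    ⟨_, arrowBimodule I J, ⟨subset_rfl, fun _ hN hX _ _ => le_antisymm hN hX⟩, rfl⟩

lemma GeneratesArrowBimodule.arrowBimoduleRank_le {I J : TwoSidedIdeal (A ⧸ Ring.jacobson A)}
    {X : Set (A ⧸ Ring.jacobson A ^ 2)} (hX : GeneratesArrowBimodule I J X) :
    arrowBimoduleRank I J ≤ Cardinal.mk X :=
  csInf_le' ⟨X, hX, rfl⟩

lemma arrowBimodule_eq_bot_of_rank_eq_zero {I J : TwoSidedIdeal (A ⧸ Ring.jacobson A)}
    (h : arrowBimoduleRank I J = 0) : arrowBimodule I J = ⊥ := by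
  obtain ⟨X, ⟨-, hX⟩, hc⟩ := exists_generatesArrowBimodule I J
  rw [h, Cardinal.mk_eq_zero_iff, Set.isEmpty_coe_sort] at hc
  refine (hX ⊥ bot_le (by simp [hc]) ?_ ?_).symm <;>
  · intro a _ m hm
    rw [AddSubgroup.mem_bot] at hm ⊢
    simp [hm]

open scoped Pointwise in
/-- A minimal ideal of `A` modulo its radical is generated by each of its nonzero elements. -/
lemma exists_mem_closure_sub_mem_jacobson {I : TwoSidedIdeal (A ⧸ Ring.jacobson A)} (hI : IsAtom I)
    {e : A} (he : Ideal.Quotient.mk (Ring.jacobson A) e ∈ I) (he0 : e ∉ Ring.jacobson A) {a : A}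
    (ha : Ideal.Quotient.mk (Ring.jacobson A) a ∈ I) :
    ∃ z ∈ AddSubgroup.closure {z | ∃ c d : A, z = c * e * d}, a - z ∈ Ring.jacobson A := by
  have hspan : TwoSidedIdeal.span {Ideal.Quotient.mk (Ring.jacobson A) e} = I := by
    refine (hI.le_iff.1 (TwoSidedIdeal.span_le.2 (by simpa using he))).resolve_left fun h => he0 ?_
    have : Ideal.Quotient.mk (Ring.jacobson A) e ∈
        TwoSidedIdeal.span {Ideal.Quotient.mk (Ring.jacobson A) e} :=
      TwoSidedIdeal.subset_span (Set.mem_singleton _)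
    rwa [h, TwoSidedIdeal.mem_bot, Ideal.Quotient.eq_zero_iff_mem] at this
  rw [← hspan, TwoSidedIdeal.mem_span_iff_mem_addSubgroup_closure] at ha
  have hle : AddSubgroup.closure ((Set.univ : Set (A ⧸ Ring.jacobson A)) *
      {Ideal.Quotient.mk (Ring.jacobson A) e} * Set.univ) ≤
      (AddSubgroup.closure {z | ∃ c d : A, z = c * e * d}).map
        (Ideal.Quotient.mk (Ring.jacobson A)).toAddMonoidHom := by
    rw [AddSubgroup.closure_le]
    rintro _ ⟨_, ⟨c, -, _, rfl, rfl⟩, d, -, rfl⟩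
    obtain ⟨c, rfl⟩ := Ideal.Quotient.mk_surjective c
    obtain ⟨d, rfl⟩ := Ideal.Quotient.mk_surjective d
    exact ⟨c * e * d, AddSubgroup.subset_closure ⟨c, d, rfl⟩, by simp⟩
  obtain ⟨z, hz, hza⟩ := hle ha
  exact ⟨z, hz, Ideal.Quotient.eq.1 hza.symm⟩

end Generators

/-! ### The radical and its square in a full corner -/

namespace IsFullCorner

variable {k : Type w} {A B : Type u} [Field k] [Ring A] [Algebra k A] [Ring B]
    [Algebra k B] {ε : A} {φ : B →ₙₐ[k] A}

lemma compress_add (h : IsFullCorner ε φ) (x y : A) :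
    h.compress (x + y) = h.compress x + h.compress y :=
  h.injective (by simp [mul_add, add_mul])

lemma compress_mem_jacobson (h : IsFullCorner ε φ) {x : A} (hx : x ∈ Ring.jacobson A) :
    h.compress x ∈ Ring.jacobson B := by
  rw [← h.map_mem_jacobson_iff, h.map_compress]
  exact Ideal.mul_mem_right _ _ (Ideal.mul_mem_left _ _ hx)

lemma map_mem_jacobson_sq (h : IsFullCorner ε φ) {b : B} (hb : b ∈ Ring.jacobson B ^ 2) :
    φ b ∈ Ring.jacobson A ^ 2 := by
  refine jacobson_sq_induction (p := fun b => φ b ∈ Ring.jacobson A ^ 2) hb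
    (fun y hy z hz => ?_) fun y z hy hz => ?_
  · rw [map_mul]
    exact mul_mem_jacobson_sq (h.map_mem_jacobson_iff.2 hy) (h.map_mem_jacobson_iff.2 hz)
  · rw [map_add]
    exact Ideal.add_mem _ hy hz

/-- Inserting `1 = ∑ a ε b` gives `ε y z ε = ∑ (ε y a ε) (ε b z ε)`, a sum of products of radical
elements of the corner. -/
lemma compress_mem_jacobson_sq (h : IsFullCorner ε φ) {x : A} (hx : x ∈ Ring.jacobson A ^ 2) :
    h.compress x ∈ Ring.jacobson B ^ 2 := by
  refine jacobson_sq_induction (p := fun x => h.compress x ∈ Ring.jacobson B ^ 2) hx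
    (fun y hy z hz => ?_) fun y z hy hz => ?_
  · obtain ⟨T, a, ha⟩ := h.exists_sum_eq_one
    have : h.compress (y * z) = ∑ b ∈ T, h.compress (y * a b) * h.compress (b * z) := by
      apply h.injective
      rw [h.map_compress, map_sum]
      nth_rw 1 [← mul_one y]
      rw [← ha]
      simp only [Finset.mul_sum, Finset.sum_mul, map_mul, h.map_compress]
      refine Finset.sum_congr rfl fun b _ => ?_
      rw [show ε * (y * a b) * ε * (ε * (b * z) * ε) = ε * (y * a b) * (ε * ε) * (b * z) * ε by
        simp only [mul_assoc], h.isIdempotentElem.eq]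
      simp only [mul_assoc]
    rw [this]
    exact Ideal.sum_mem _ fun b _ => mul_mem_jacobson_sq
      (h.compress_mem_jacobson (Ideal.mul_mem_right _ _ hy))
      (h.compress_mem_jacobson (Ideal.mul_mem_left _ _ hz))
  · rw [h.compress_add]
    exact Ideal.add_mem _ hy hz

end IsFullCorner

namespace IsBasicAlgebra

variable {k : Type w} {A B : Type u} [Field k] [Ring A] [Algebra k A] [FiniteDimensional k A]
  [Ring B] [Algebra k B] {n : ℕ} {e : Fin n → A} {φ : B →ₙₐ[k] A}

lemma finiteDimensional (hB : IsBasicAlgebra e φ) : FiniteDimensional k B :=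
  FiniteDimensional.of_injective (φ : B →ₗ[k] A) hB.injective

variable {e' : Fin n → B}

/-- A minimal ideal of `A` modulo its radical contains the primitive idempotents acting
nontrivially on the same simple module. -/
lemma mk_mem_of_smul_ne_zero [IsAlgClosed k] (hB : IsBasicAlgebra e φ)
    (he : IsBasicDecomposition e') (hφ : ∀ i, φ (e' i) = e i)
    {I : TwoSidedIdeal (A ⧸ Ring.jacobson A)} {S : Type u} [AddCommGroup S] [Module A S]
    [IsSimpleModule A S] (hI : ActsNontrivially I S) {i : Fin n} {s : S} (hs : e i • s ≠ 0) :
    Ideal.Quotient.mk (Ring.jacobson A) (e i) ∈ I := by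
  have := hB.finiteDimensional
  have h := hB.isFullCorner
  have hee : e i * e i = e i := (hB.idempotents.primitive i).1
  obtain ⟨a, ha, t, ht⟩ := hI
  obtain ⟨c, hc⟩ := exists_smul_eq_of_ne_zero (R := A) ht (e i • s)
  obtain ⟨d, hd⟩ := exists_smul_eq_of_ne_zero (R := A) hs t
  -- `z` represents an element of `I`, lies in the corner of `e i` and sends `s` to `e i • s`.
  -- Modulo the radical it is therefore a nonzero multiple of `e i`.
  set z := e i * c * a * d * e i with hz
  have hzs : z • s = e i • s := by
    rw [hz, mul_smul, mul_smul, hd, mul_smul, mul_smul, hc, ← mul_smul, hee]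
  have hzI : Ideal.Quotient.mk (Ring.jacobson A) z ∈ I := by
    simp only [hz, map_mul]
    exact I.mul_mem_right _ _ (I.mul_mem_right _ _ (I.mul_mem_left _ _ ha))
  have hφb : φ (e' i * h.compress z) = z := by
    rw [map_mul, hφ, h.map_compress, ← mul_assoc, ← mul_assoc, hB.idempotents.mul_sum, hz]
    simp only [mul_assoc]
    rw [hB.idempotents.mul_sum, ← mul_assoc (e i) (e i), hee]
  set χ := he.char k i (h.compress z)
  have hr : z - χ • e i ∈ Ring.jacobson A := by
    have := h.map_mem_jacobson_iff.2 (he.mul_sub_char_mem_jacobson (k := k) i (h.compress z))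
    rwa [map_sub, hφb, map_smul, hφ] at this
  have hχ : χ ≠ 0 := by
    intro h0
    rw [h0, zero_smul, sub_zero] at hr
    exact hs (by rw [← hzs, jacobson_smul_eq_zero hr])
  have h1 : Ideal.Quotient.mk (Ring.jacobson A) (e i) =
      Ideal.Quotient.mk (Ring.jacobson A) (algebraMap k A χ⁻¹) *
        Ideal.Quotient.mk (Ring.jacobson A) z := by
    rw [Ideal.Quotient.eq.2 hr, ← map_mul, ← Algebra.smul_def, smul_smul, inv_mul_cancel₀ hχ,
      one_smul]
  rw [h1]
  exact I.mul_mem_left _ _ hzI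

/-! ### Ranks of the arrow bimodules of `A` and `B` -/

section Compare

variable {I J : TwoSidedIdeal (A ⧸ Ring.jacobson A)} {I' J' : TwoSidedIdeal (B ⧸ Ring.jacobson B)}
  {i j : Fin n}

/-- The map `r/r² → r/r²` induced by `φ` carries generators to generators: a sub-bimodule containing
the images contains all `e i * φ x * e j`, and these generate because `I` and `J` are generated as
ideals by `e i` and `e j`. -/
lemma arrowBimoduleRank_le (hB : IsBasicAlgebra e φ) (he : IsBasicDecomposition e')
    (hφ : ∀ i, φ (e' i) = e i) (hI : IsAtom I) (hJ : IsAtom J)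
    (hIe : Ideal.Quotient.mk (Ring.jacobson A) (e i) ∈ I)
    (hJe : Ideal.Quotient.mk (Ring.jacobson A) (e j) ∈ J)
    (hI' : ∀ b, Ideal.Quotient.mk (Ring.jacobson B) b ∈ I' ↔
      ∃ c : k, b - c • e' i ∈ Ring.jacobson B)
    (hJ' : ∀ b, Ideal.Quotient.mk (Ring.jacobson B) b ∈ J' ↔
      ∃ c : k, b - c • e' j ∈ Ring.jacobson B) :
    arrowBimoduleRank I J ≤ arrowBimoduleRank I' J' := by
  have h := hB.isFullCorner
  have hnot (l : Fin n) : e l ∉ Ring.jacobson A := by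
    rw [← hφ, h.map_mem_jacobson_iff]
    intro hl
    obtain ⟨m, hm, s, hs⟩ := he.exists_isMaximal l
    have := isSimpleModule_quotient hm
    exact hs (jacobson_smul_eq_zero hl s)
  have hmem (l : Fin n) (L : TwoSidedIdeal (A ⧸ Ring.jacobson A))
      (hL : Ideal.Quotient.mk (Ring.jacobson A) (e l) ∈ L) (b : B)
      (hb : ∃ c : k, b - c • e' l ∈ Ring.jacobson B) :
      Ideal.Quotient.mk (Ring.jacobson A) (φ b) ∈ L := by
    obtain ⟨c, hc⟩ := hb
    have h1 := h.map_mem_jacobson_iff.2 hc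
    rw [map_sub, map_smul, hφ] at h1
    rw [Ideal.Quotient.eq.2 h1, Algebra.smul_def, map_mul]
    exact L.mul_mem_left _ _ hL
  -- The choice of representative is harmless, since `φ` maps the squared radical into the squared
  -- radical.
  let f (m : B ⧸ Ring.jacobson B ^ 2) : A ⧸ Ring.jacobson A ^ 2 :=
    Ideal.Quotient.mk _ (φ (Function.surjInv Ideal.Quotient.mk_surjective m))
  have hf (b : B) : f (Ideal.Quotient.mk _ b) = Ideal.Quotient.mk _ (φ b) := by
    refine Ideal.Quotient.eq.2 ?_
    rw [← map_sub]
    exact h.map_mem_jacobson_sq (Ideal.Quotient.eq.1 (Function.surjInv_eq _ _))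
  have hf_mem {m : B ⧸ Ring.jacobson B ^ 2} (hm : m ∈ arrowSpace k (e' i) (e' j)) :
      f m ∈ arrowBimodule I J := by
    obtain ⟨x, hx, rfl⟩ := mem_arrowSpace.1 hm
    rw [hf, map_mul φ, map_mul φ, hφ, hφ]
    exact AddSubgroup.subset_closure ⟨_, _, _, hIe, h.map_mem_jacobson_iff.2 hx, hJe, rfl⟩
  have hW : arrowBimodule I' J' = (arrowSpace k (e' i) (e' j)).toAddSubgroup :=
    arrowBimodule_eq_arrowSpace hI' hJ'
  obtain ⟨X, ⟨hXW, hX⟩, hXc⟩ := exists_generatesArrowBimodule I' J'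
  rw [← hXc]
  refine le_trans (GeneratesArrowBimodule.arrowBimoduleRank_le (X := f '' X) ⟨?_, ?_⟩)
    Cardinal.mk_image_le
  · rintro _ ⟨m, hm, rfl⟩
    have := hXW hm
    rw [hW] at this
    exact hf_mem this
  intro N hN hXN hNl hNr
  refine le_antisymm hN ?_
  have hsub (x : B) (hx : x ∈ Ring.jacobson B) :
      Ideal.Quotient.mk _ (e i * φ x * e j) ∈ N := by
    let F : (B ⧸ Ring.jacobson B ^ 2) →+ (A ⧸ Ring.jacobson A ^ 2) :=
      { toFun := f
        map_zero' := by rw [← map_zero (Ideal.Quotient.mk _), hf, map_zero, map_zero]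
        map_add' := fun x y => by
          obtain ⟨x, rfl⟩ := Ideal.Quotient.mk_surjective x
          obtain ⟨y, rfl⟩ := Ideal.Quotient.mk_surjective y
          rw [← map_add, hf, hf, hf, map_add, map_add] }
    have hF (a m) : F (Ideal.Quotient.mk _ a * m) = Ideal.Quotient.mk _ (φ a) * F m := by
      obtain ⟨x, rfl⟩ := Ideal.Quotient.mk_surjective m
      change f _ = _ * f _
      rw [← map_mul, hf, hf, map_mul, map_mul]
    have hF' (a m) : F (m * Ideal.Quotient.mk _ a) = F m * Ideal.Quotient.mk _ (φ a) := by
      obtain ⟨x, rfl⟩ := Ideal.Quotient.mk_surjective m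
      change f _ = f _ * _
      rw [← map_mul, hf, hf, map_mul, map_mul]
    -- The pullback of `N` is a sub-bimodule containing the generators `X`, hence everything.
    have key := hX (arrowBimodule I' J' ⊓ N.comap F) inf_le_left
      (fun m hm => ⟨hXW hm, hXN ⟨m, hm, rfl⟩⟩)
      (by
        rintro a ha m ⟨hm, hmN⟩
        refine ⟨?_, ?_⟩
        · rw [hW] at hm ⊢
          obtain ⟨c, hc⟩ := (hI' a).1 ha
          rw [mk_mul_of_mem_arrowSpace (he.isIdempotentElem i) hm hc]
          exact (arrowSpace k (e' i) (e' j)).smul_mem c hm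
        · change F _ ∈ N
          rw [hF]
          exact hNl _ (hmem i I hIe a ((hI' a).1 ha)) _ hmN)
      (by
        rintro a ha m ⟨hm, hmN⟩
        refine ⟨?_, ?_⟩
        · rw [hW] at hm ⊢
          obtain ⟨c, hc⟩ := (hJ' a).1 ha
          rw [mul_mk_of_mem_arrowSpace (he.isIdempotentElem j) hm hc]
          exact (arrowSpace k (e' i) (e' j)).smul_mem c hm
        · change F _ ∈ N
          rw [hF']
          exact hNr _ (hmem j J hJe a ((hJ' a).1 ha)) _ hmN)
    have h1 : Ideal.Quotient.mk (Ring.jacobson B ^ 2) (e' i * x * e' j) ∈ arrowBimodule I' J' := by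
      rw [hW]
      exact mem_arrowSpace.2 ⟨x, hx, rfl⟩
    rw [← key] at h1
    have h2 : f _ ∈ N := h1.2
    rwa [hf, map_mul φ, map_mul φ, hφ, hφ] at h2
  have hgen (c d x : A) (hx : x ∈ Ring.jacobson A) :
      Ideal.Quotient.mk (Ring.jacobson A ^ 2) (c * e i * x * (e j * d)) ∈ N := by
    have hei : e i * e i = e i := (hB.idempotents.primitive i).1
    have hej : e j * e j = e j := (hB.idempotents.primitive j).1
    -- The middle factor comes from `B`, as `ε` is absorbed by `e i` and `e j`; the outer factors
    -- represent elements of `I` and `J`.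
    have h1 : c * e i * x * (e j * d) =
        (c * e i) * (e i * φ (h.compress x) * e j) * (e j * d) := by
      rw [h.map_compress,
        show e i * ((∑ l, e l) * x * ∑ l, e l) * e j =
          (e i * ∑ l, e l) * x * ((∑ l, e l) * e j) by simp only [mul_assoc],
        hB.idempotents.mul_sum, hB.idempotents.sum_mul,
        show c * e i * (e i * x * e j) * (e j * d) = c * (e i * e i) * x * (e j * e j * d) by
          simp only [mul_assoc], hei, hej]
    rw [h1, map_mul, map_mul]
    refine hNr _ ?_ _ (hNl _ ?_ _ (hsub _ (h.compress_mem_jacobson hx)))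
    · rw [map_mul]
      exact J.mul_mem_right _ _ hJe
    · rw [map_mul]
      exact I.mul_mem_left _ _ hIe
  refine (AddSubgroup.closure_le _).2 ?_
  rintro _ ⟨a, x, b, ha, hx, hb, rfl⟩
  -- Replacing `a` and `b` by sums of terms `c * e i * d` and `c * e j * d` changes `a * x * b` only
  -- by an element of `r²`.
  obtain ⟨z, hz, hza⟩ := exists_mem_closure_sub_mem_jacobson hI hIe (hnot i) ha
  obtain ⟨y, hy, hyb⟩ := exists_mem_closure_sub_mem_jacobson hJ hJe (hnot j) hb
  have h1 : Ideal.Quotient.mk (Ring.jacobson A ^ 2) (a * x * b) =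
      Ideal.Quotient.mk (Ring.jacobson A ^ 2) (z * x * y) := by
    refine Ideal.Quotient.eq.2 ?_
    have : a * x * b - z * x * y = (a - z) * x * b + z * (x * (b - y)) := by
      simp only [sub_mul, mul_sub, mul_assoc]
      abel
    rw [this]
    exact Ideal.add_mem _ (mul_mem_jacobson_sq_right _ (mul_mem_jacobson_sq hza hx))
      (mul_mem_jacobson_sq_left _ (mul_mem_jacobson_sq hx hyb))
  rw [SetLike.mem_coe, h1]
  clear h1 hza hyb
  induction hz using AddSubgroup.closure_induction with
  | zero => simp
  | add z z' _ _ hz hz' => rw [add_mul, add_mul, map_add]; exact N.add_mem hz hz'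
  | neg z _ hz => rw [neg_mul, neg_mul, map_neg]; exact N.neg_mem hz
  | mem z hz =>
    obtain ⟨c, d, rfl⟩ := hz
    induction hy using AddSubgroup.closure_induction with
    | zero => simp
    | add y y' _ _ hy hy' => rw [mul_add, map_add]; exact N.add_mem hy hy'
    | neg y _ hy => rw [mul_neg, map_neg]; exact N.neg_mem hy
    | mem y hy =>
      obtain ⟨c', d', rfl⟩ := hy
      have := hgen c d' (d * x * c') (Ideal.mul_mem_right _ _ (Ideal.mul_mem_left _ _ hx))
      simpa only [mul_assoc] using this

/-- If the bimodule of `A` is zero, each `e i * φ x * e j` is in the squared radical of `A`, and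
compressing returns `e' i * x * e' j` to that of `B`. This gives density. -/
lemma arrowBimoduleRank_eq_zero (hB : IsBasicAlgebra e φ) (he : IsBasicDecomposition e')
    (hφ : ∀ i, φ (e' i) = e i)
    (hIe : Ideal.Quotient.mk (Ring.jacobson A) (e i) ∈ I)
    (hJe : Ideal.Quotient.mk (Ring.jacobson A) (e j) ∈ J)
    (hI' : ∀ b, Ideal.Quotient.mk (Ring.jacobson B) b ∈ I' ↔
      ∃ c : k, b - c • e' i ∈ Ring.jacobson B)
    (hJ' : ∀ b, Ideal.Quotient.mk (Ring.jacobson B) b ∈ J' ↔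
      ∃ c : k, b - c • e' j ∈ Ring.jacobson B)
    (h0 : arrowBimoduleRank I J = 0) : arrowBimoduleRank I' J' = 0 := by
  have h := hB.isFullCorner
  have hbot := arrowBimodule_eq_bot_of_rank_eq_zero h0
  rw [arrowBimoduleRank_eq_rank_arrowSpace (he.isIdempotentElem i) (he.isIdempotentElem j) hI' hJ']
  have : arrowSpace k (e' i) (e' j) = ⊥ := by
    rw [eq_bot_iff]
    intro m hm
    obtain ⟨x, hx, rfl⟩ := mem_arrowSpace.1 hm
    have h1 : Ideal.Quotient.mk (Ring.jacobson A ^ 2) (e i * φ x * e j) ∈ arrowBimodule I J :=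
      AddSubgroup.subset_closure ⟨_, _, _, hIe, h.map_mem_jacobson_iff.2 hx, hJe, rfl⟩
    rw [hbot, AddSubgroup.mem_bot, Ideal.Quotient.eq_zero_iff_mem, ← hφ, ← hφ, ← map_mul,
      ← map_mul] at h1
    have h2 := h.compress_mem_jacobson_sq h1
    rw [h.compress_map] at h2
    exact (Submodule.mem_bot k).2 (Ideal.Quotient.eq_zero_iff_mem.2 h2)
  rw [this, rank_bot]

end Compare

end IsBasicAlgebra

/-- With `S_i` and `S_j` belonging to `e a` and `e b`, both numbers are `dim e b (r/r²) e a`; for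
left modules the target idempotent stands on the left. -/
lemma IsBasicDecomposition.arrowCount_toOrdinary {k : Type w} {B : Type u} [Field k] [Ring B]
    [Algebra k B] {n : ℕ} {e : Fin n → B} [IsAlgClosed k] [FiniteDimensional k B]
    (he : IsBasicDecomposition e) (i j : NaturalQuiver B) :
    (i.toOrdinary k).arrowCount (j.toOrdinary k) = i.arrowCount j := by
  have hi := IsSimpleModule.nontrivial B (i.toOrdinary k).simple
  have hj := IsSimpleModule.nontrivial B (j.toOrdinary k).simple
  obtain ⟨a, s, hs⟩ := he.exists_smul_ne_zero (S := (i.toOrdinary k).simple)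
  obtain ⟨b, t, ht⟩ := he.exists_smul_ne_zero (S := (j.toOrdinary k).simple)
  rw [OrdinaryQuiver.arrowCount, he.rank_ext_eq_rank_arrowSpace _ _ hs ht, NaturalQuiver.arrowCount,
    arrowBimoduleRank_eq_rank_arrowSpace (he.isIdempotentElem b) (he.isIdempotentElem a)
      (he.mk_mem_iff (k := k) j.2 j.actsOn_toOrdinary ht) (he.mk_mem_iff (k := k) i.2 i.actsOn_toOrdinary hs)]

namespace IsBasicAlgebra

variable {k : Type w} {A B : Type u} [Field k] [Ring A] [Algebra k A] [FiniteDimensional k A]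
  [Ring B] [Algebra k B] [IsAlgClosed k] {n : ℕ} {e : Fin n → A} {φ : B →ₙₐ[k] A}

/-- Minimal ideals of `A` and of `B` modulo their radicals that act on corresponding simple
modules share a primitive idempotent. -/
lemma exists_idempotent (hB : IsBasicAlgebra e φ) {e' : Fin n → B}
    (he : IsBasicDecomposition e') (hφ : ∀ i, φ (e' i) = e i) {i : NaturalQuiver A}
    {i' : NaturalQuiver B}
    (h : i'.toOrdinary k = hB.isFullCorner.vertexMap (i.toOrdinary k)) :
    ∃ l : Fin n, Ideal.Quotient.mk (Ring.jacobson A) (e l) ∈ i.1 ∧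
      ∀ b, Ideal.Quotient.mk (Ring.jacobson B) b ∈ i'.1 ↔
        ∃ c : k, b - c • e' l ∈ Ring.jacobson B := by
  have := hB.finiteDimensional
  have := IsSimpleModule.nontrivial B (i'.toOrdinary k).simple
  obtain ⟨l, t, ht⟩ := he.exists_smul_ne_zero (S := (i'.toOrdinary k).simple)
  refine ⟨l, ?_, he.mk_mem_iff (k := k) i'.2 i'.actsOn_toOrdinary ht⟩
  let f : (i'.toOrdinary k).simple ≃ₗ[B] hB.isFullCorner.Corner (i.toOrdinary k).simple :=
    h ▸ hB.isFullCorner.vertexEquiv (i.toOrdinary k)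
  refine hB.mk_mem_of_smul_ne_zero he hφ (i.actsOn_toOrdinary (k := k))
    (s := hB.isFullCorner.incl (f t)) ?_
  rw [← hφ, ← hB.isFullCorner.incl_smul, ← map_smul, ← map_zero hB.isFullCorner.incl]
  exact fun h0 => ht (f.map_eq_zero_iff.1 (hB.isFullCorner.incl_injective h0))

lemma arrowCount_le (hB : IsBasicAlgebra e φ) {i j : NaturalQuiver A} {i' j' : NaturalQuiver B}
    (hi : i'.toOrdinary k = hB.isFullCorner.vertexMap (i.toOrdinary k))
    (hj : j'.toOrdinary k = hB.isFullCorner.vertexMap (j.toOrdinary k)) :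
    i.arrowCount j ≤ i'.arrowCount j' ∧ (i.arrowCount j = 0 → i'.arrowCount j' = 0) := by
  obtain ⟨e', he, hφ⟩ := hB.isBasicDecomposition
  obtain ⟨l, hl, hl'⟩ := hB.exists_idempotent he hφ hi
  obtain ⟨m, hm, hm'⟩ := hB.exists_idempotent he hφ hj
  exact ⟨hB.arrowBimoduleRank_le he hφ j.2 i.2 hm hl hm' hl',
    hB.arrowBimoduleRank_eq_zero he hφ hm hl hm' hl'⟩

end IsBasicAlgebra

theorem proposition1p2 {k : Type w} {A B : Type u} [Field k] [Ring A] [Algebra k A]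
    [FiniteDimensional k A] [Ring B] [Algebra k B]
    {n : ℕ} (e : Fin n → A) (φ : B →ₙₐ[k] A) (hB : IsBasicAlgebra e φ) :
    ∃ F : OrdinaryQuiver k A ⥤q OrdinaryQuiver k B,
      (IsQuiverIso F ∧ ∀ x, IsCornerOf e φ x (F.obj x)) ∧
      (IsAlgClosed k →
        ∃ G : OrdinaryQuiver k B ⥤q NaturalQuiver B,
          (IsQuiverIso G ∧ ∀ y, ActsOn (G.obj y) y) ∧
          ∃ (H : NaturalQuiver A ⥤q OrdinaryQuiver k A)
            (H' : NaturalQuiver A ⥤q OrdinaryQuiver k B)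
            (H'' : NaturalQuiver A ⥤q NaturalQuiver B),
            (IsDenseSubquiverEmbedding H ∧ ∀ i, ActsOn i (H.obj i)) ∧
            (IsDenseSubquiverEmbedding H' ∧ ∀ i, H'.obj i = F.obj (H.obj i)) ∧
            (IsDenseSubquiverEmbedding H'' ∧ ∀ i, H''.obj i = G.obj (H'.obj i))) := by
  have h := hB.isFullCorner
  have hBfin := hB.finiteDimensional
  obtain ⟨F, hF, hFobj⟩ := exists_prefunctor_isQuiverIso h.vertexMap h.vertexMap_bijective
    fun x y => by
      rw [OrdinaryQuiver.mk_hom, OrdinaryQuiver.mk_hom, h.arrowCount_vertexMap]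
  refine ⟨F, ⟨hF, fun x => by rw [hFobj]; exact h.isCornerOf_vertexMap x⟩, fun _ => ?_⟩
  obtain ⟨e', he, -⟩ := hB.isBasicDecomposition
  let g : NaturalQuiver B ≃ OrdinaryQuiver k B :=
    Equiv.ofBijective _ NaturalQuiver.toOrdinary_bijective
  have hg (y : OrdinaryQuiver k B) : (g.symm y).toOrdinary k = y := g.apply_symm_apply y
  have hcount (x y : OrdinaryQuiver k B) :
      (g.symm x).arrowCount (g.symm y) = x.arrowCount y := by
    rw [← he.arrowCount_toOrdinary (k := k), hg, hg]
  obtain ⟨G, hG, hGobj⟩ := exists_prefunctor_isQuiverIso g.symm g.symm.bijective fun x y => by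
    rw [OrdinaryQuiver.mk_hom, NaturalQuiver.mk_hom, hcount]
  -- All three dense embeddings rest on this comparison with `Δ_B`, carried to `Γ_B` and `Γ_A` by
  -- the equalities of arrow numbers. They are chosen independently on arrows and agree only on
  -- vertices.
  have hle (i j : NaturalQuiver A) :=
    hB.arrowCount_le (i := i) (j := j) (hg (h.vertexMap (i.toOrdinary k)))
      (hg (h.vertexMap (j.toOrdinary k)))
  have hbij : Function.Bijective (NaturalQuiver.toOrdinary k (A := A)) :=
    NaturalQuiver.toOrdinary_bijective
  obtain ⟨H, hH, hHobj⟩ := exists_prefunctor_isDenseSubquiverEmbedding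
    (NaturalQuiver.toOrdinary k (A := A)) hbij
    (fun i j => by
      rw [OrdinaryQuiver.mk_hom, NaturalQuiver.mk_hom, ← h.arrowCount_vertexMap, ← hcount]
      exact (hle i j).1)
    (fun i j => by
      rw [OrdinaryQuiver.mk_hom, NaturalQuiver.mk_hom, ← h.arrowCount_vertexMap, ← hcount]
      exact (hle i j).2)
  obtain ⟨H', hH', hHobj'⟩ := exists_prefunctor_isDenseSubquiverEmbedding
    (fun i : NaturalQuiver A => h.vertexMap (i.toOrdinary k)) (h.vertexMap_bijective.comp hbij)
    (fun i j => by
      rw [OrdinaryQuiver.mk_hom, NaturalQuiver.mk_hom, ← hcount]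
      exact (hle i j).1)
    (fun i j => by
      rw [OrdinaryQuiver.mk_hom, NaturalQuiver.mk_hom, ← hcount]
      exact (hle i j).2)
  obtain ⟨H'', hH'', hHobj''⟩ := exists_prefunctor_isDenseSubquiverEmbedding
    (fun i : NaturalQuiver A => g.symm (h.vertexMap (i.toOrdinary k)))
    (g.symm.bijective.comp (h.vertexMap_bijective.comp hbij))
    (fun i j => by
      rw [NaturalQuiver.mk_hom, NaturalQuiver.mk_hom]
      exact (hle i j).1)
    (fun i j => by
      rw [NaturalQuiver.mk_hom, NaturalQuiver.mk_hom]
      exact (hle i j).2)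
  refine ⟨G, ⟨hG, fun y => ?_⟩, H, H', H'', ⟨hH, fun i => ?_⟩, ⟨hH', fun i => ?_⟩,
    ⟨hH'', fun i => ?_⟩⟩
  · have := NaturalQuiver.actsOn_toOrdinary (k := k) (g.symm y)
    rw [hg] at this
    rwa [hGobj]
  · rw [hHobj]
    exact i.actsOn_toOrdinary
  · rw [hHobj', hFobj, hHobj]
  · rw [hHobj'', hGobj, hHobj']
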